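/- Let $d\ge 1$ and let $\Theta$ be a compact (connected) $d$-dimensional smooth Riemannian manifold without boundary, with Riemannian distance $\mathrm{dist}$ and with the probability measure $\tau$ proportional to the Riemannian volume. Let $\mathcal M(\Theta)$ be the finite signed Borel measures on $\Theta$, with the total variation norm $\|\cdot\|$. An \emph{objective} is a function $\bar F=\bar G+\bar H:\mathcal M(\Theta)\to\mathbb R\cup\{+\infty\}$ with $\bar G(\mu)=R\big(\int\Phi\,d\mu\big)$, where $\Phi:\Theta\to\mathcal F$ is a continuous map to a Hilbert space $\mathcal F$, $R:\mathcal F\to\mathbb R$ is convex and differentiable with Lipschitz gradient, and $\bar H$ is a sum of functions from the following list, where $\lambda\ge 0$: the convex indicator of the probability measures, the convex indicator of the nonnegative measures, $\lambda\|\mu\|$, and the convex indicator of $\{\mu:\lambda\|\mu\|\le 1\}$. Put $\bar G'[\mu](\theta)=\langle\nabla R(\int\Phi\,d\mu),\Phi(\theta)\rangle_{\mathcal F}$, and for $f\in L^1(\tau)$ put $F(f)=\bar F(f\tau)$, $G(f)=\bar G(f\tau)$, $H(f)=\bar H(f\tau)$, $G'[f]=\bar G'[f\tau]$. Consider four settings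 for an objective that has a minimizer $\mu^*\in\mathcal M(\Theta)$, in the sense that $\bar F(\mu^*)=\min\bar F=\inf_{L^1(\tau)}F$: - (I), with $q=1$: $\Phi$ is Lipschitz; - (I*), with $q=2$: $\Phi$ is Lipschitz and $\bar G'[\mu^*]=0$; - (II), with $q=2$: $\Phi$ is $C^1$ and $\nabla_\theta\Phi$ is Lipschitz; - (II*), with $q=4$: $\Phi$ is $C^1$, $\nabla_\theta\Phi$ is Lipschitz and $\bar G'[\mu^*]=0$. For a step size $s>0$, let PGM with the $L^2$ geometry $\eta_2(x)=x^2/2$ be the proximal gradient method that starts at $f_0=1$, where it is required that $H(f_0)<+\infty$, and iterates $$f_{k+1}=\arg\min_{f\in L^1(\tau)}\Big\{G(f_k)+\int G'[f_k]\,(f-f_k)\,d\tau+H(f)+\frac1{2s}\int (f-f_k)^2\,d\tau\Big\}.$$ Proposition. For each of the four settings there is an objective $\bar F$ on $\Theta$ that satisfies the setting, such that for every step size $s>0$ the PGM iterates $(f_k)_{k\ge0}$ started at $f_0=1$ exist and are unique, and there is a constant $c>0$ (which may depend on $\Theta$, $\bar F$ and $s$, but not on $k$) with $$F(f_k)-\inf_{L^1(\tau)}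 F\;\ge\; c\,k^{-\frac{q}{d+q}}\qquad\text{for all }k\ge1.$$ -/

import Mathlib

open MeasureTheory Set Bundle
open scoped Manifold ContDiff ENNReal NNReal InnerProductSpace

noncomputable section

/-- The admissible summands of the regularizer `H̄`, with regularization parameter `lam ≥ 0`:
the convex indicator of the probability measures, the convex indicator of the nonnegative measures,
`lam * ‖μ‖`, and the convex indicator of `{μ | lam * ‖μ‖ ≤ 1}`. -/
inductive Regularizer
  | prob
  | nonneg
  | tv
  | tvBall

open scoped Classical in
/-- Value in `[0, ∞]` of a regularizer at a finite signed measure; `μ.variation univ` is the total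
variation norm of `μ`. -/
def Regularizer.eval {Θ : Type*} [MeasurableSpace Θ] (lam : ℝ≥0) (μ : SignedMeasure Θ) :
    Regularizer → ℝ≥0∞
  | prob => if 0 ≤ μ ∧ μ univ = 1 then 0 else ⊤
  | nonneg => if 0 ≤ μ then 0 else ⊤
  | tv => lam * μ.variation univ
  | tvBall => if lam * μ.variation univ ≤ 1 then 0 else ⊤

/-- An objective `F̄(μ) = R (∫ Φ dμ) + H̄(μ)` where `Φ` is a continuous map to a Hilbert space `𝓕`,
`R : 𝓕 → ℝ` is convex and differentiable with a Lipschitz gradient, and `H̄` is a sum of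
admissible regularizers. -/
structure Objective (Θ : Type*) [TopologicalSpace Θ] where
  𝓕 : Type
  [normedAddCommGroup : NormedAddCommGroup 𝓕]
  [innerProductSpace : InnerProductSpace ℝ 𝓕]
  [completeSpace : CompleteSpace 𝓕]
  Φ : C(Θ, 𝓕)
  R : 𝓕 → ℝ
  convexOn_R : ConvexOn ℝ univ R
  differentiable_R : Differentiable ℝ R
  lipschitz_gradient_R : ∃ K : ℝ≥0, LipschitzWith K (gradient R)
  lam : ℝ≥0
  regularizers : List Regularizer

attribute [instance] Objective.normedAddCommGroup Objective.innerProductSpace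
  Objective.completeSpace

namespace Objective

variable {Θ : Type*} [TopologicalSpace Θ] [MeasurableSpace Θ] (P : Objective Θ)

/-- `Ḡ(μ) = R (∫ Φ dμ)`. -/
def Gbar (μ : SignedMeasure Θ) : ℝ := P.R (∫ᵛ θ, P.Φ θ ∂<•μ)

/-- The differential of `Ḡ` at `μ`, represented by the function `⟪∇R (∫ Φ dμ), Φ θ⟫` of `θ`. -/
def GbarDeriv (μ : SignedMeasure Θ) (θ : Θ) : ℝ :=
  ⟪gradient P.R (∫ᵛ θ', P.Φ θ' ∂<•μ), P.Φ θ⟫_ℝ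

/-- `H̄(μ)`, with values in `[0, ∞]`. -/
def Hbar (μ : SignedMeasure Θ) : ℝ≥0∞ := (P.regularizers.map (Regularizer.eval P.lam μ)).sum

/-- `F̄ = Ḡ + H̄`, with values in `ℝ ∪ {+∞}`. -/
def Fbar (μ : SignedMeasure Θ) : EReal := (P.Gbar μ : EReal) + (P.Hbar μ : EReal)

variable (τ : Measure Θ)

/-- `G(f) = Ḡ(f τ)`. -/
def G (f : Θ →₁[τ] ℝ) : ℝ := P.Gbar (τ.withDensityᵥ f)

/-- `G'[f] = Ḡ'[f τ]`. -/
def GDeriv (f : Θ →₁[τ] ℝ) (θ : Θ) : ℝ := P.GbarDeriv (τ.withDensityᵥ f) θ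

/-- `H(f) = H̄(f τ)`. -/
def H (f : Θ →₁[τ] ℝ) : ℝ≥0∞ := P.Hbar (τ.withDensityᵥ f)

/-- `F(f) = F̄(f τ)`. -/
def F (f : Θ →₁[τ] ℝ) : EReal := P.Fbar (τ.withDensityᵥ f)

/-- `μ` minimizes `F̄` over the finite signed measures, and `F̄ μ` is the infimum of `F` over
`L¹(τ)`. -/
def IsMinimizer (μ : SignedMeasure Θ) : Prop :=
  (∀ ν : SignedMeasure Θ, P.Fbar μ ≤ P.Fbar ν) ∧ P.Fbar μ = ⨅ f : Θ →₁[τ] ℝ, P.F τ f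

end Objective

/-- The power function `η_p(s) = |s|^p / (p (p - 1))`. -/
def powerEta (p : ℝ) (s : ℝ) : ℝ := |s| ^ p / (p * (p - 1))

/-- The Bregman divergence of `η` on the real line. -/
def bregman (η : ℝ → ℝ) (a b : ℝ) : ℝ := η a - η b - deriv η b * (a - b)

/-- The integrated Bregman divergence `∫ D_η(f θ, g θ) dτ(θ)`, with values in `[0, ∞]`; the
integrand is nonnegative for convex `η`. -/
def bregmanInt {Θ : Type*} [MeasurableSpace Θ] (η : ℝ → ℝ) (τ : Measure Θ) (f g : Θ →₁[τ] ℝ) :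
    ℝ≥0∞ :=
  ∫⁻ θ, ENNReal.ofReal (bregman η (f θ) (g θ)) ∂τ

namespace Objective

variable {Θ : Type*} [TopologicalSpace Θ] [MeasurableSpace Θ] (P : Objective Θ) (τ : Measure Θ)

/-- The function of `f` minimized in one step of the proximal gradient method from `g`:
`G(g) + ∫ G'[g] (f - g) dτ + H(f) + (1 / s) D_η(f, g)`. -/
def pgmStep (η : ℝ → ℝ) (s : ℝ) (g f : Θ →₁[τ] ℝ) : EReal :=
  ((P.G τ g + ∫ θ, P.GDeriv τ g θ * (f θ - g θ) ∂τ : ℝ) : EReal)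
    + (P.H τ f : EReal)
    + ((ENNReal.ofReal (1 / s) * bregmanInt η τ f g : ℝ≥0∞) : EReal)

/-- `f` is a sequence of iterates of the (Bregman) proximal gradient method with
distance-generating function `η` and step size `s`, started at `f₀ ∈ dom H`. -/
structure IsPGM (η : ℝ → ℝ) (s : ℝ) (f₀ : Θ →₁[τ] ℝ) (f : ℕ → (Θ →₁[τ] ℝ)) : Prop where
  init_mem : P.H τ f₀ ≠ ⊤
  init : f 0 = f₀
  step : ∀ k, IsMinOn (P.pgmStep τ η s (f k)) univ (f (k + 1))

end Objective

/-- The map `Φ` from a manifold to a normed space is `C¹` and has a Lipschitz derivative. The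
Lipschitz condition is the local one, read in the charts; on a compact Riemannian manifold this is
the global Lipschitz continuity of the gradient. -/
def HasLipschitzGradient {d : ℕ} {Θ V : Type*} [TopologicalSpace Θ]
    [ChartedSpace (EuclideanSpace ℝ (Fin d)) Θ] [NormedAddCommGroup V] [NormedSpace ℝ V]
    (Φ : Θ → V) : Prop :=
  ContMDiff (𝓡 d) 𝓘(ℝ, V) 1 Φ ∧
    ∀ θ : Θ, LocallyLipschitzOn (extChartAt (𝓡 d) θ).target
      (fderiv ℝ (Φ ∘ (extChartAt (𝓡 d) θ).symm))

/-- The four settings (I), (I*), (II), (II*). -/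
inductive Setting
  | I
  | Istar
  | II
  | IIstar

/-- The exponent `q` attached to a setting. -/
def Setting.q : Setting → ℕ
  | I => 1
  | Istar => 2
  | II => 2
  | IIstar => 4

/-- The assumptions of each setting, for an objective with a minimizer `μ`. -/
def Setting.Holds (d : ℕ) {Θ : Type*} [MetricSpace Θ] [MeasurableSpace Θ]
    [ChartedSpace (EuclideanSpace ℝ (Fin d)) Θ] (P : Objective Θ) (μ : SignedMeasure Θ) :
    Setting → Prop
  | I => ∃ K : ℝ≥0, LipschitzWith K P.Φ
  | Istar => (∃ K : ℝ≥0, LipschitzWith K P.Φ) ∧ ∀ θ, P.GbarDeriv μ θ = 0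
  | II => HasLipschitzGradient (d := d) P.Φ
  | IIstar => HasLipschitzGradient (d := d) P.Φ ∧ ∀ θ, P.GbarDeriv μ θ = 0

end

/-! Take `Φ = V` scalar with `V ≥ 0` vanishing only at `θ₀` and comparable to `dist(·, θ₀) ^ p`, let
`H̄` be the indicator of the probability measures, and let `R x = x` or `R x = x² / 2`. The Dirac
mass at `θ₀` is a minimizer with value `0`, and for `R x = x² / 2` the derivative `Ḡ'` vanishes
there. The sublevel set `{V < ρ}` has measure of order `ρ ^ α` with `α = d / p`.

Write `m k = ∫ V f_k` and `N k = ∫ f_k²`. Two facts compete. A density with `∫ f² ≤ K ρ ^ (-α)`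
cannot put most of its mass on `{V < ε ρ}` for small `ε`, so `∫ V f ≥ c ρ`
(`exists_mul_le_integral_mul_of_sublevel_le`). On the other hand `N k` grows slowly: comparing the
three-point inequalities of the steps with the uniform density on `{V < ρ}` gives `N k ≤ A ρ ^ (-α)
+ 4 s ρ ∑ w j`, where `w j = R' (m j)` (`integral_sq_add_sum_le`).

For linear `R` the weights are `1`; balancing `ρ ^ (-α) = k ρ` gives `m k ≥ c k ^ (-1 / (α + 1))`,
of exponent `p / (d + p)`. For quadratic `R` the weights are `m j`; the term discarded above,
combined with Cauchy–Schwarz, yields `∑ m j ≤ C k ρ`, the balance becomes `ρ ^ (-α) = k ρ²`, and the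
value `m k ^ 2 / 2` has exponent `2 p / (d + 2 p)`. Taking `p = 1` and `p = 2` gives the four values
of `q`. -/

noncomputable section

/-! ### Charts of a Riemannian manifold are locally bi-Lipschitz -/

section Geometry
open Filter Metric Manifold
open scoped Topology

attribute [local instance] normedAddCommGroupTangentSpaceVectorSpace
attribute [local instance] normedSpaceTangentSpaceVectorSpace

variable {E : Type*} [NormedAddCommGroup E] [NormedSpace ℝ E]
  {H : Type*} [TopologicalSpace H] (I : ModelWithCorners ℝ E H)
  {M : Type*} [PseudoEMetricSpace M] [ChartedSpace H M]
  [RiemannianBundle (fun x : M => TangentSpace I x)]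
  [IsManifold I 1 M] [IsContinuousRiemannianBundle E (fun x : M => TangentSpace I x)]
  [IsRiemannianManifold I M]

/-- The inverse of an extended chart is Lipschitz on a neighborhood of the base point. -/
theorem exists_lipschitzOnWith_extChartAt_symm (x : M) :
    ∃ C : ℝ≥0, ∃ r : ℝ, 0 < r ∧
      LipschitzOnWith C (extChartAt I x).symm (ball (extChartAt I x x) r ∩ range I) := by
  rcases eventually_enorm_mfderivWithin_symm_extChartAt_lt I x with ⟨C, C_pos, hC⟩
  obtain ⟨S, hS, hSC⟩ := hC.exists_mem
  obtain ⟨r, r_pos, hr⟩ : ∃ r > 0,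
      ball (extChartAt I x x) r ∩ range I ⊆ (extChartAt I x).target ∩ S :=
    mem_nhdsWithin_iff.1 (inter_mem (extChartAt_target_mem_nhdsWithin x) hS)
  refine ⟨C, r, r_pos, fun a ha b hb => ?_⟩
  -- The segment from `a` to `b` stays in the convex set `ball ∩ range I`; its image under the
  -- inverse chart is a curve of length at most `C` times that of the segment.
  let η := ContinuousAffineMap.lineMap (R := ℝ) a b
  set γ := (extChartAt I x).symm ∘ η
  have hη : Icc 0 1 ⊆ ⇑η ⁻¹' ((extChartAt I x).target ∩ S) := by
    simp only [← image_subset_iff, ContinuousAffineMap.coe_lineMap_eq,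
     ← segment_eq_image_lineMap, η]
    apply Subset.trans _ hr
    exact ((convex_ball _ _).inter I.convex_range).segment_subset ha hb
  simp only [preimage_inter, subset_inter_iff] at hη
  have η_smooth : CMDiff[Icc 0 1] 1 η := by
    apply ContMDiff.contMDiffOn
    rw [contMDiff_iff_contDiff]
    exact ContinuousAffineMap.contDiff _
  rw [IsRiemannianManifold.out (I := I)]
  have : riemannianEDist I ((extChartAt I x).symm a) ((extChartAt I x).symm b)
      ≤ pathELength I γ 0 1 := by
    apply riemannianEDist_le_pathELength _ _ _ zero_le_one
    · exact (contMDiffOn_extChartAt_symm x).comp η_smooth hη.1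
    · simp [γ, η, ContinuousAffineMap.coe_lineMap_eq]
    · simp [γ, η, ContinuousAffineMap.coe_lineMap_eq]
  apply this.trans
  rw [← lintegral_fderiv_lineMap_eq_edist, pathELength_eq_lintegral_mfderivWithin_Icc,
    ← lintegral_const_mul' _ _ ENNReal.coe_ne_top]
  apply setLIntegral_mono' measurableSet_Icc (fun t ht ↦ ?_)
  have : mfderiv[Icc 0 1] γ t =
      (mfderiv[range I] (extChartAt I x).symm (η t)) ∘L (mfderiv[Icc 0 1] η t) := by
    apply mfderivWithin_comp
    · exact mdifferentiableWithinAt_extChartAt_symm (hη.1 ht)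
    · exact η_smooth.mdifferentiableOn one_ne_zero t ht
    · exact hη.1.trans (preimage_mono (extChartAt_target_subset_range x))
    · rw [uniqueMDiffWithinAt_iff_uniqueDiffWithinAt]
      exact uniqueDiffOn_Icc zero_lt_one t ht
  have : mfderiv[Icc 0 1] γ t 1 =
      (mfderiv[range I] (extChartAt I x).symm (η t)) (mfderiv[Icc 0 1] η t 1) := congr($this 1)
  rw [this]
  apply (ContinuousLinearMap.le_opENorm _ _).trans
  gcongr
  · exact (hSC _ (hη.2 ht)).le
  · simp only [mfderivWithin_eq_fderivWithin]
    exact le_of_eq rfl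

/-- An extended chart is Lipschitz on a neighborhood of the base point. -/
theorem exists_lipschitzOnWith_extChartAt (x : M) :
    ∃ C : ℝ≥0, ∃ r : ℝ≥0∞, 0 < r ∧ LipschitzOnWith C (extChartAt I x) (Metric.eball x r) := by
  rcases eventually_enorm_mfderiv_extChartAt_lt I x with ⟨C, C_pos, hC⟩
  obtain ⟨R, R_pos, hR⟩ := EMetric.mem_nhds_iff.1
    (inter_mem hC (extChartAt_source_mem_nhds (I := I) x))
  -- With radius `R / 3`, a nearly shortest curve from `y` to `z` has length below `2 R / 3` and
  -- starts within `R / 3` of `x`, so it never leaves the ball of radius `R` where the derivative of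
  -- the chart is controlled.
  refine ⟨C, R / 3, by simp [R_pos.ne'], fun y hy z hz => ?_⟩
  have R3 : R / 3 + (R / 3 + R / 3) = R := by
    rw [← add_assoc]; exact ENNReal.add_thirds R
  have hyz : edist y z < R / 3 + R / 3 :=
    (edist_triangle_right y z x).trans_lt (ENNReal.add_lt_add hy hz)
  refine le_of_forall_gt fun L hL => ?_
  have hL' : edist y z < min (L / C) (R / 3 + R / 3) := by
    refine lt_min ?_ hyz
    rw [ENNReal.lt_div_iff_mul_lt (by simp [C_pos.ne']) (by simp), mul_comm]
    exact hL
  rw [IsRiemannianManifold.out (I := I)] at hL'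
  rcases exists_lt_locally_constant_of_riemannianEDist_lt hL' zero_lt_one
    with ⟨γ, hγx, hγy, γ_smooth, hγ, -⟩
  have hmem : ∀ t ∈ Icc (0 : ℝ) 1, γ t ∈ Metric.eball x R := by
    intro t ht
    have h1 : edist y (γ t) ≤ pathELength I γ 0 1 := by
      rw [IsRiemannianManifold.out (I := I)]
      exact (riemannianEDist_le_pathELength γ_smooth.contMDiffOn hγx rfl ht.1).trans
        (pathELength_mono le_rfl ht.2)
    rw [Metric.mem_eball]
    calc edist (γ t) x ≤ edist y x + edist y (γ t) := by
          rw [edist_comm y (γ t), add_comm]; exact edist_triangle _ _ _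
      _ < R / 3 + (R / 3 + R / 3) :=
          ENNReal.add_lt_add hy (h1.trans_lt (hγ.trans_le (min_le_right _ _)))
      _ = R := R3
  let γ' := extChartAt I x ∘ γ
  have hC' : CMDiff[Icc 0 1] 1 γ' :=
    contMDiffOn_extChartAt.comp (I' := I) (t := (chartAt H x).source)
      γ_smooth.contMDiffOn (fun t' ht' ↦ by
        simpa [extChartAt_source] using (hR (hmem t' ht')).2)
  have : ‖γ' 1 - γ' 0‖ₑ < L := by
    calc
      ‖γ' 1 - γ' 0‖ₑ
    _ ≤ ∫⁻ t' in Icc 0 1, ‖derivWithin γ' (Icc 0 1) t'‖ₑ := by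
      apply enorm_sub_le_lintegral_derivWithin_Icc_of_contDiffOn_Icc _ zero_le_one
      rwa [← contMDiffOn_iff_contDiffOn]
    _ = ∫⁻ t' in Icc 0 1, ‖mfderiv[Icc 0 1] γ' t' 1‖ₑ := by
      simp_rw [← fderivWithin_derivWithin, mfderivWithin_eq_fderivWithin]
      rfl
    _ ≤ ∫⁻ t' in Icc 0 1, C * ‖mfderiv[Icc 0 1] γ t' 1‖ₑ := by
      apply setLIntegral_mono' measurableSet_Icc (fun t' ht' ↦ ?_)
      have : mfderiv[Icc 0 1] γ' t' =
          (mfderiv% (extChartAt I x) (γ t')) ∘L (mfderiv[Icc 0 1] γ t') := by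
        apply mfderiv_comp_mfderivWithin
        · refine mdifferentiableAt_extChartAt ?_
          simpa [extChartAt_source] using (hR (hmem t' ht')).2
        · exact (γ_smooth.mdifferentiable one_ne_zero).mdifferentiableOn _ ht'
        · rw [uniqueMDiffWithinAt_iff_uniqueDiffWithinAt]
          exact uniqueDiffOn_Icc zero_lt_one _ ht'
      have : mfderiv[Icc 0 1] γ' t' 1 =
          (mfderiv% (extChartAt I x) (γ t')) (mfderiv[Icc 0 1] γ t' 1) :=
        congr($this 1)
      rw [this]
      apply (ContinuousLinearMap.le_opENorm _ _).trans
      gcongr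
      exact (hR (hmem t' ht')).1.le
    _ = C * pathELength I γ 0 1 := by
      rw [lintegral_const_mul' _ _ ENNReal.coe_ne_top,
          pathELength_eq_lintegral_mfderivWithin_Icc]
    _ < C * (L / C) := by
      gcongr
      · exact ENNReal.coe_ne_top
      · exact hγ.trans_le (min_le_left _ _)
    _ ≤ L := ENNReal.mul_div_le
  rw [edist_comm, edist_eq_enorm_sub]
  simpa [γ', hγx, hγy] using this

end Geometry
-- Volumes of balls and of sublevel sets
section Geometry
open Filter Metric Manifold
open scoped Topology

/-- The normalizing factor depends only on `d`, so it is the same on both sides of the usual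
Hausdorff measure bound. -/
theorem LipschitzOnWith.euclideanHausdorffMeasure_image_le {X Y : Type*} [EMetricSpace X]
    [EMetricSpace Y] [MeasurableSpace X] [BorelSpace X] [MeasurableSpace Y] [BorelSpace Y]
    {K : ℝ≥0} {f : X → Y} {s : Set X} (h : LipschitzOnWith K f s) (d : ℕ) :
    Measure.euclideanHausdorffMeasure d (f '' s) ≤
      (K : ℝ≥0∞) ^ d * Measure.euclideanHausdorffMeasure d s := by
  have := h.hausdorffMeasure_image_le (d := d) (by positivity)
  rw [ENNReal.rpow_natCast] at this
  simp only [Measure.euclideanHausdorffMeasure_def, Measure.smul_apply, ENNReal.smul_def,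
    smul_eq_mul]
  rw [mul_left_comm]
  gcongr

/-- On a compact space, a local comparison of two continuous functions near the only zero of the
larger one is a global comparison up to a constant. -/
theorem exists_forall_le_mul_of_eventually_le_mul {X : Type*} [TopologicalSpace X] [CompactSpace X]
    {V W : X → ℝ} (hV : Continuous V) (hW : Continuous W) {x₀ : X} (hW₀ : ∀ x, 0 ≤ W x)
    (hWpos : ∀ x, x ≠ x₀ → 0 < W x) {C : ℝ} (h : ∀ᶠ x in 𝓝 x₀, V x ≤ C * W x) :
    ∃ C' : ℝ, 0 < C' ∧ ∀ x, V x ≤ C' * W x := by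
  obtain ⟨U, hU, hUo, hxU⟩ := eventually_nhds_iff.1 h
  have hne : ∀ x ∈ Uᶜ, 0 < W x := fun x hx => hWpos x fun h => hx (h ▸ hxU)
  -- Off the neighborhood, `V / W` is continuous on a compact set, hence bounded.
  have hcont : ContinuousOn (fun x => V x / W x) Uᶜ :=
    hV.continuousOn.div hW.continuousOn fun x hx => (hne x hx).ne'
  obtain ⟨B, hB⟩ := (hUo.isClosed_compl.isCompact.bddAbove_image hcont)
  refine ⟨max 1 (max C B), lt_max_of_lt_left one_pos, fun x => ?_⟩
  by_cases hx : x ∈ U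
  · exact (hU x hx).trans (mul_le_mul_of_nonneg_right
      ((le_max_left _ _).trans (le_max_right _ _)) (hW₀ x))
  · have : V x / W x ≤ B := hB ⟨x, hx, rfl⟩
    rw [div_le_iff₀ (hne x hx)] at this
    exact this.trans (mul_le_mul_of_nonneg_right
      ((le_max_right _ _).trans (le_max_right _ _)) (hW₀ x))

variable {d : ℕ} {Θ : Type*} [MetricSpace Θ]
    [ChartedSpace (EuclideanSpace ℝ (Fin d)) Θ] [IsManifold (𝓡 d) ∞ Θ]

/-- In a chart the derivative is again `C¹`, and `C¹` maps are locally Lipschitz. -/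
theorem ContMDiff.hasLipschitzGradient {V : Type*} [NormedAddCommGroup V]
    [NormedSpace ℝ V] {f : Θ → V} (hf : ContMDiff (𝓡 d) 𝓘(ℝ, V) ∞ f) :
    HasLipschitzGradient (d := d) f := by
  refine ⟨hf.of_le (by simp), fun θ => ?_⟩
  have hopen : IsOpen (extChartAt (𝓡 d) θ).target := isOpen_extChartAt_target θ
  have h1 : ContDiffOn ℝ ∞ (f ∘ (extChartAt (𝓡 d) θ).symm) (extChartAt (𝓡 d) θ).target := by
    rw [← contMDiffOn_iff_contDiffOn]
    exact hf.comp_contMDiffOn (contMDiffOn_extChartAt_symm θ)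
  have h2 : ContDiffOn ℝ 1 (fderiv ℝ (f ∘ (extChartAt (𝓡 d) θ).symm))
      (extChartAt (𝓡 d) θ).target := h1.fderiv_of_isOpen hopen (by norm_cast)
  intro y hy
  obtain ⟨K, t, ht, hK⟩ := (h2.contDiffAt (hopen.mem_nhds hy)).exists_lipschitzOnWith
  exact ⟨K, t, mem_nhdsWithin_of_mem_nhds ht, hK⟩

variable [RiemannianBundle (fun x : Θ => TangentSpace (𝓡 d) x)]
    [IsContMDiffRiemannianBundle (𝓡 d) ∞ (EuclideanSpace ℝ (Fin d))
      (fun x : Θ => TangentSpace (𝓡 d) x)]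

theorem isContinuousRiemannianBundle_tangentSpace :
    IsContinuousRiemannianBundle (EuclideanSpace ℝ (Fin d))
      (fun x : Θ => TangentSpace (𝓡 d) x) := by
  obtain ⟨g, hg, hg'⟩ := IsContMDiffRiemannianBundle.exists_contMDiff (IB := 𝓡 d) (n := ∞)
    (F := EuclideanSpace ℝ (Fin d)) (E := fun x : Θ => TangentSpace (𝓡 d) x)
  exact ⟨g, hg.continuous, hg'⟩

variable [IsRiemannianManifold (𝓡 d) Θ]

/-- On a compact Riemannian manifold there is a smooth function comparable to the squared
distance to a point. -/
theorem exists_contMDiff_comparable_dist_sq [CompactSpace Θ] (x₀ : Θ) :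
    ∃ V : Θ → ℝ, ContMDiff (𝓡 d) 𝓘(ℝ, ℝ) ∞ V ∧ ∃ a b : ℝ, 0 < a ∧ 0 < b ∧
      ∀ x, a * dist x x₀ ^ 2 ≤ V x ∧ V x ≤ b * dist x x₀ ^ 2 := by
  have := isContinuousRiemannianBundle_tangentSpace (d := d) (Θ := Θ)
  let f : SmoothBumpFunction (𝓡 d) x₀ := Classical.arbitrary _
  set φ := extChartAt (𝓡 d) x₀ with hφ
  -- The bump function glues the squared chart distance near `x₀` to a positive function; the term
  -- `1 - f` prevents zeros where the bump is not `1`.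
  let V : Θ → ℝ := fun x => f x • ‖φ x - φ x₀‖ ^ 2 + (1 - f x)
  have hV : ContMDiff (𝓡 d) 𝓘(ℝ, ℝ) ∞ V := by
    refine (f.contMDiff_smul ?_).add (contMDiff_const.sub f.contMDiff)
    have h1 : ContMDiffOn (𝓡 d) 𝓘(ℝ, EuclideanSpace ℝ (Fin d)) ∞ φ
        (chartAt (EuclideanSpace ℝ (Fin d)) x₀).source := contMDiffOn_extChartAt
    have h2 : ContDiff ℝ ∞ fun y : EuclideanSpace ℝ (Fin d) => ‖y - φ x₀‖ ^ 2 :=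
      (contDiff_id.sub contDiff_const).norm_sq ℝ
    exact h2.contMDiff.comp_contMDiffOn h1
  have hVeq : ∀ᶠ x in 𝓝 x₀, V x = ‖φ x - φ x₀‖ ^ 2 := by
    filter_upwards [f.eventuallyEq_one] with x hx
    simp [V, hx]
  have hV0 : ∀ x, 0 ≤ V x := fun x =>
    add_nonneg (smul_nonneg f.nonneg (by positivity)) (sub_nonneg.2 f.le_one)
  have hVpos : ∀ x, x ≠ x₀ → 0 < V x := by
    intro x hx
    refine (hV0 x).lt_of_ne' fun h => hx ?_
    have hfa : 0 ≤ f x • ‖φ x - φ x₀‖ ^ 2 := smul_nonneg f.nonneg (by positivity)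
    have hfb : 0 ≤ 1 - f x := sub_nonneg.2 f.le_one
    have hf1 : f x = 1 := by
      have : f x • ‖φ x - φ x₀‖ ^ 2 + (1 - f x) = 0 := h
      linarith
    have hφx : φ x = φ x₀ := by
      have : f x • ‖φ x - φ x₀‖ ^ 2 + (1 - f x) = 0 := h
      rw [hf1, one_smul, sub_self, add_zero] at this
      exact sub_eq_zero.1 (norm_eq_zero.1 (pow_eq_zero_iff two_ne_zero |>.1 this))
    have hxs : x ∈ (chartAt (EuclideanSpace ℝ (Fin d)) x₀).source :=
      f.support_subset_source (by rw [Function.mem_support, hf1]; exact one_ne_zero)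
    exact φ.injOn (by rwa [hφ, extChartAt_source]) (mem_extChartAt_source x₀) hφx
  refine ⟨V, hV, ?_⟩
  have hdc : Continuous fun x : Θ => dist x x₀ ^ 2 := by fun_prop
  obtain ⟨C₁, -, h₁⟩ := eventually_riemannianEDist_le_edist_extChartAt (𝓡 d) x₀
  obtain ⟨C₂, r, hr, h₂⟩ := exists_lipschitzOnWith_extChartAt (𝓡 d) x₀
  obtain ⟨A, hA, hA'⟩ := exists_forall_le_mul_of_eventually_le_mul (C := C₁ ^ 2) hdc hV.continuous
    hV0 hVpos (x₀ := x₀) (by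
      filter_upwards [h₁, hVeq] with x hx hx'
      rw [hx', ← mul_pow]
      gcongr
      rw [← IsRiemannianManifold.out (I := 𝓡 d), edist_nndist, edist_nndist] at hx
      have : nndist x₀ x ≤ C₁ * nndist (φ x₀) (φ x) := by exact_mod_cast hx
      rw [dist_comm x x₀, ← dist_eq_norm, dist_comm (φ x)]
      exact_mod_cast this)
  obtain ⟨B, hB, hB'⟩ := exists_forall_le_mul_of_eventually_le_mul (C := C₂ ^ 2) hV.continuous hdc
    (fun x => by positivity) (fun x hx => by have := dist_pos.2 hx; positivity) (x₀ := x₀) (by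
      filter_upwards [Metric.eball_mem_nhds x₀ hr, hVeq] with x hx hx'
      rw [hx', ← mul_pow, ← dist_eq_norm]
      gcongr
      exact h₂.dist_le_mul x hx x₀ (Metric.mem_eball_self hr))
  refine ⟨A⁻¹, B, by positivity, hB, fun x => ⟨?_, hB' x⟩⟩
  rw [inv_mul_le_iff₀ hA]
  exact hA' x

variable [MeasurableSpace Θ] [BorelSpace Θ]

/-- The normalized Riemannian volume of balls around a point is comparable to the power `d` of the
radius. -/
theorem exists_measureReal_ball_comparable_pow (τ : Measure Θ) [IsProbabilityMeasure τ]
    (hτ : ∃ c : ℝ≥0∞, τ = c • (Measure.euclideanHausdorffMeasure d : Measure Θ)) (x₀ : Θ) :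
    ∃ c C : ℝ, 0 < c ∧ 0 < C ∧ (∀ r : ℝ, 0 < r → r ≤ 1 → c * r ^ d ≤ τ.real (ball x₀ r)) ∧
      ∀ r : ℝ, 0 < r → τ.real (ball x₀ r) ≤ C * r ^ d := by
  obtain ⟨t, rfl⟩ := hτ
  set τ : Measure Θ := t • (Measure.euclideanHausdorffMeasure d : Measure Θ) with hτ
  -- Total mass `1` forces the normalization `t` to be nonzero and finite.
  have ht0 : t ≠ 0 := by
    rintro rfl
    have : τ univ = 1 := measure_univ
    simp [hτ] at this
  have htop : t ≠ ⊤ := by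
    rintro rfl
    have : τ univ = 1 := measure_univ
    rw [hτ, Measure.smul_apply, smul_eq_mul, ENNReal.top_mul'] at this
    split_ifs at this <;> simp at this
  have := isContinuousRiemannianBundle_tangentSpace (d := d) (Θ := Θ)
  set φ := extChartAt (𝓡 d) x₀ with hφ
  obtain ⟨C₁, r₁, hr₁, h₁⟩ := exists_lipschitzOnWith_extChartAt_symm (𝓡 d) x₀
  obtain ⟨C₂, r₂, hr₂, h₂⟩ := exists_lipschitzOnWith_extChartAt (𝓡 d) x₀
  simp only [modelWithCornersSelf_coe, range_id, inter_univ] at h₁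
  obtain ⟨ρ₁, hρ₁, hb₁⟩ : ∃ ρ > 0, ball (φ x₀) ρ ⊆ ball (φ x₀) r₁ ∩ φ.target :=
    Metric.mem_nhds_iff.1 (inter_mem (ball_mem_nhds _ hr₁) (extChartAt_target_mem_nhds x₀))
  obtain ⟨ρ₂, hρ₂, hb₂⟩ : ∃ ρ > 0, ball x₀ ρ ⊆ Metric.eball x₀ r₂ ∩ φ.source :=
    Metric.mem_nhds_iff.1 (inter_mem (Metric.eball_mem_nhds _ hr₂)
      (extChartAt_source_mem_nhds x₀))
  replace h₁ := h₁.mono (hb₁.trans inter_subset_left)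
  replace h₂ := h₂.mono (hb₂.trans inter_subset_left)
  have hvol : ∀ (z : EuclideanSpace ℝ (Fin d)) (r : ℝ), 0 < r →
      (Measure.euclideanHausdorffMeasure d) (ball z r) =
        ENNReal.ofReal (r ^ d) * volume (ball (0 : EuclideanSpace ℝ (Fin d)) 1) := by
    intro z r hr
    rw [EuclideanSpace.euclideanHausdorffMeasure_eq_volume, Measure.addHaar_ball_of_pos _ _ hr]
    simp
  set κ := volume (ball (0 : EuclideanSpace ℝ (Fin d)) 1) with hκ
  have hκ0 : 0 < κ.toReal := ENNReal.toReal_pos (measure_ball_pos _ _ one_pos).ne'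
    measure_ball_lt_top.ne
  have htr : 0 < t.toReal := ENNReal.toReal_pos ht0 htop
  have upper : ∀ r, 0 < r → r ≤ ρ₂ → (C₂ + 1) * r ≤ ρ₁ →
      τ.real (ball x₀ r) ≤ (t.toReal * C₁ ^ d * (C₂ + 1) ^ d * κ.toReal) * r ^ d := by
    intro r hr hrρ₂ hrρ₁
    -- The `+ 1` in `C₂ + 1` keeps the inclusion in an open ball strict, and the radius positive,
    -- even if `C₂ = 0`.
    have hsub : ball x₀ r ⊆ φ.symm '' ball (φ x₀) ((C₂ + 1) * r) := by
      intro y hy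
      have hy' := hb₂ (ball_subset_ball hrρ₂ hy)
      refine ⟨φ y, ?_, φ.left_inv hy'.2⟩
      have := h₂.dist_le_mul y (ball_subset_ball hrρ₂ hy) x₀ (mem_ball_self hρ₂)
      rw [mem_ball] at hy ⊢
      calc _ ≤ _ := this
        _ ≤ C₂ * r := by gcongr
        _ < _ := by linarith
    have hm := (measure_mono hsub).trans
      ((h₁.mono (ball_subset_ball hrρ₁)).euclideanHausdorffMeasure_image_le d)
    rw [hvol _ _ (by positivity)] at hm
    have hm' : τ (ball x₀ r) ≤
        t * (C₁ ^ d * (ENNReal.ofReal (((C₂ + 1) * r) ^ d) * κ)) := by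
      rw [hτ, Measure.smul_apply, smul_eq_mul]
      gcongr
    refine (ENNReal.toReal_mono ?_ hm').trans_eq ?_
    · exact ENNReal.mul_ne_top htop (ENNReal.mul_ne_top (by simp)
        (ENNReal.mul_ne_top (by simp) measure_ball_lt_top.ne))
    · simp only [ENNReal.toReal_mul, ENNReal.toReal_pow, ENNReal.coe_toReal]
      rw [ENNReal.toReal_ofReal (by positivity), mul_pow]
      ring
  have lower : ∀ r, 0 < r → r ≤ ρ₂ → r ≤ ρ₁ →
      (t.toReal * κ.toReal / ((C₁ + 1) ^ d * (C₂ + 1) ^ d)) * r ^ d ≤ τ.real (ball x₀ r) := by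
    intro r hr hrρ₂ hrρ₁
    have hsub : ball (φ x₀) (r / (C₁ + 1)) ⊆ φ '' ball x₀ r := by
      intro z hz
      have hz1 : z ∈ ball (φ x₀) ρ₁ := by
        refine ball_subset_ball ((div_le_self hr.le ?_).trans hrρ₁) hz
        have := C₁.2
        linarith
      refine ⟨φ.symm z, ?_, φ.right_inv (hb₁ hz1).2⟩
      have := h₁.dist_le_mul z hz1 (φ x₀) (mem_ball_self hρ₁)
      rw [hφ, extChartAt_to_inv] at this
      rw [mem_ball] at hz ⊢
      rw [lt_div_iff₀ (by positivity)] at hz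
      calc _ ≤ _ := this
        _ ≤ dist z (φ x₀) * (C₁ + 1) := by
          rw [mul_comm]; gcongr; linarith
        _ < _ := hz
    have hm := (measure_mono hsub).trans
      ((h₂.mono (ball_subset_ball hrρ₂)).euclideanHausdorffMeasure_image_le d)
    rw [hvol _ _ (by positivity)] at hm
    have hm' : t * (ENNReal.ofReal ((r / (C₁ + 1)) ^ d) * κ) ≤ C₂ ^ d * τ (ball x₀ r) := by
      rw [hτ, Measure.smul_apply, smul_eq_mul, mul_left_comm _ t]
      gcongr
    have hm'' := ENNReal.toReal_mono
      (ENNReal.mul_ne_top (by simp) (measure_ne_top τ _)) hm'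
    simp only [ENNReal.toReal_mul, ENNReal.toReal_pow, ENNReal.coe_toReal] at hm''
    rw [ENNReal.toReal_ofReal (by positivity)] at hm''
    change _ ≤ (C₂ : ℝ) ^ d * τ.real (ball x₀ r) at hm''
    have h3 : (C₂ : ℝ) ^ d * τ.real (ball x₀ r) ≤ (C₂ + 1) ^ d * τ.real (ball x₀ r) := by
      gcongr; linarith
    rw [div_mul_eq_mul_div, div_le_iff₀ (by positivity)]
    rw [div_pow] at hm''
    have h4 := hm''.trans h3
    have h5 : t.toReal * κ.toReal * r ^ d =
        (t.toReal * (r ^ d / (C₁ + 1) ^ d * κ.toReal)) * (C₁ + 1) ^ d := by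
      field_simp
    rw [h5]
    exact (mul_le_mul_of_nonneg_right h4 (by positivity)).trans_eq (by ring)
  obtain ⟨r₀, hr₀, hr₀1, h01, h02, h03⟩ : ∃ r₀ : ℝ, 0 < r₀ ∧ r₀ ≤ 1 ∧ r₀ ≤ ρ₂ ∧ r₀ ≤ ρ₁ ∧
      (C₂ + 1) * r₀ ≤ ρ₁ := by
    have h2 : (0 : ℝ) ≤ C₂ := C₂.2
    refine ⟨min 1 (min ρ₂ (ρ₁ / (C₂ + 1))), by positivity, min_le_left _ _,
      (min_le_right _ _).trans (min_le_left _ _), ?_, ?_⟩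
    · refine ((min_le_right _ _).trans (min_le_right _ _)).trans (div_le_self hρ₁.le (by linarith))
    · rw [← le_div_iff₀' (by positivity)]
      exact (min_le_right _ _).trans (min_le_right _ _)
  -- Both estimates hold up to radius `r₀`. The lower one extends to `r ≤ 1` by shrinking the ball
  -- to radius `r₀ * r`; the upper one extends to `r ≥ r₀` because the mass is at most `1`.
  refine ⟨(t.toReal * κ.toReal / ((C₁ + 1) ^ d * (C₂ + 1) ^ d)) * r₀ ^ d,
    max (t.toReal * C₁ ^ d * (C₂ + 1) ^ d * κ.toReal) (1 / r₀ ^ d), by positivity, by positivity,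
    fun r hr hr1 => ?_, fun r hr => ?_⟩
  · have h6 : r₀ * r ≤ r₀ := mul_le_of_le_one_right hr₀.le hr1
    have h7 : r₀ * r ≤ r := mul_le_of_le_one_left hr.le hr₀1
    have := lower (r₀ * r) (by positivity) (h6.trans h01) (h6.trans h02)
    rw [mul_pow, ← mul_assoc] at this
    exact this.trans (measureReal_mono (ball_subset_ball h7))
  · rcases le_total r r₀ with h | h
    · refine (upper r hr (h.trans h01) (le_trans (by gcongr) h03)).trans ?_
      gcongr
      exact le_max_left _ _
    · calc τ.real (ball x₀ r) ≤ 1 := measureReal_le_one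
        _ ≤ 1 / r₀ ^ d * r ^ d := by
          rw [one_div, inv_mul_eq_div, le_div_iff₀ (by positivity), one_mul]
          gcongr
        _ ≤ _ := by gcongr; exact le_max_right _ _

/-- Comparable volumes of balls give comparable volumes of sublevel sets of functions comparable
to a power of the distance. -/
theorem exists_measureReal_sublevel_comparable_rpow {X : Type*} [MetricSpace X] [MeasurableSpace X]
    (τ : Measure X) [IsFiniteMeasure τ] {x₀ : X} {c C : ℝ} (hc : 0 < c) (hC : 0 < C)
    (hlower : ∀ r : ℝ, 0 < r → r ≤ 1 → c * r ^ d ≤ τ.real (ball x₀ r))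
    (hupper : ∀ r : ℝ, 0 < r → τ.real (ball x₀ r) ≤ C * r ^ d)
    {p : ℕ} (hp : p ≠ 0) {V : X → ℝ} {a b : ℝ} (ha : 0 < a) (hb : 0 < b)
    (hV : ∀ x, a * dist x x₀ ^ p ≤ V x ∧ V x ≤ b * dist x x₀ ^ p) :
    ∃ c' C' : ℝ, 0 < c' ∧ 0 < C' ∧ ∀ ρ : ℝ, 0 < ρ → ρ ≤ 1 →
      c' * ρ ^ ((d : ℝ) / p) ≤ τ.real {x | V x < ρ} ∧
      τ.real {x | V x < ρ} ≤ C' * ρ ^ ((d : ℝ) / p) := by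
  have hp' : (0 : ℝ) < p := by positivity
  have key : ∀ u ρ : ℝ, 0 < u → 0 < ρ →
      ((u * ρ) ^ ((1 : ℝ) / p)) ^ d = (u ^ ((1 : ℝ) / p)) ^ d * ρ ^ ((d : ℝ) / p) := by
    intro u ρ hu hρ
    rw [Real.mul_rpow hu.le hρ.le, mul_pow]
    congr 1
    rw [← Real.rpow_mul_natCast hρ.le]
    congr 1
    ring
  have key2 : ∀ y : ℝ, 0 ≤ y → (y ^ ((1 : ℝ) / p)) ^ p = y := by
    intro y hy
    rw [one_div, Real.rpow_inv_natCast_pow hy hp]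
  -- The radius `(ρ / (b + 1)) ^ (1 / p)` gives a ball inside `{V < ρ}`, with `b + 1` making the
  -- inequality strict; the radius `(ρ / a) ^ (1 / p)` gives one containing it.
  refine ⟨c * ((1 / (b + 1)) ^ ((1 : ℝ) / p)) ^ d, C * ((1 / a) ^ ((1 : ℝ) / p)) ^ d,
    by positivity, by positivity, fun ρ hρ hρ1 => ⟨?_, ?_⟩⟩
  · have h1 := hlower ((1 / (b + 1) * ρ) ^ ((1 : ℝ) / p)) (by positivity) (by
      refine Real.rpow_le_one (by positivity) ?_ (by positivity)
      refine mul_le_one₀ ?_ hρ.le hρ1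
      rw [div_le_one (by positivity)]; linarith)
    rw [key _ _ (by positivity) hρ, ← mul_assoc] at h1
    refine h1.trans (measureReal_mono fun x hx => ?_)
    rw [mem_ball] at hx
    calc V x ≤ b * dist x x₀ ^ p := (hV x).2
      _ ≤ b * ((1 / (b + 1) * ρ) ^ ((1 : ℝ) / p)) ^ p := by gcongr
      _ = b / (b + 1) * ρ := by rw [key2 _ (by positivity)]; ring
      _ < 1 * ρ := by
        gcongr
        rw [div_lt_one (by positivity)]; linarith
      _ = ρ := one_mul ρ
  · have h1 := hupper ((1 / a * ρ) ^ ((1 : ℝ) / p)) (by positivity)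
    rw [key _ _ (by positivity) hρ, ← mul_assoc] at h1
    refine le_trans (measureReal_mono fun x (hx : V x < ρ) => ?_) h1
    rw [mem_ball]
    refine lt_of_pow_lt_pow_left₀ p (by positivity) ?_
    rw [key2 _ (by positivity), one_div, inv_mul_eq_div, lt_div_iff₀ ha, mul_comm]
    exact (hV x).1.trans_lt hx

end Geometry
-- Concentration of densities and projection in `L²`
section Densities
open Filter
open scoped Topology

variable {Θ : Type*} [MeasurableSpace Θ] {τ : Measure Θ}

/-- A probability density with respect to `τ`. -/
structure IsDensity (f : Θ →₁[τ] ℝ) : Prop where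
  nonneg : 0 ≤ᵐ[τ] f
  integral_eq_one : ∫ θ, f θ ∂τ = 1

/-- A square-integrable probability density with respect to `τ`. -/
structure IsSqDensity (f : Θ →₁[τ] ℝ) : Prop extends IsDensity f where
  memLp : MemLp f 2 τ

/-- Densities with small `L²` norm have a lower bound on their integral against a function whose
sublevel sets are small. -/
theorem exists_mul_le_integral_mul_of_sublevel_le [IsProbabilityMeasure τ] {V : Θ → ℝ}
    (hVm : Measurable V) (hV0 : ∀ θ, 0 ≤ V θ) {B : ℝ} (hVB : ∀ θ, V θ ≤ B) {α C : ℝ} (hα : 0 < α)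
    (hC : 0 < C) (h : ∀ ρ : ℝ, 0 < ρ → ρ ≤ 1 → τ.real {θ | V θ < ρ} ≤ C * ρ ^ α) {K : ℝ}
    (hK : 0 < K) :
    ∃ c : ℝ, 0 < c ∧ ∀ ρ : ℝ, 0 < ρ → ρ ≤ 1 → ∀ f : Θ →₁[τ] ℝ, IsSqDensity f →
      ∫ θ, f θ ^ 2 ∂τ ≤ K * ρ ^ (-α) → c * ρ ≤ ∫ θ, V θ * f θ ∂τ := by
  -- This `ε` makes the measure of `{V < ε ρ}` times `K ρ ^ (-α)` at most `1 / 4`.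
  set ε : ℝ := min 1 ((1 / (4 * C * K)) ^ (1 / α)) with hε
  have hε0 : 0 < ε := by positivity
  have hε1 : ε ≤ 1 := min_le_left _ _
  have hεα : C * ε ^ α * K ≤ 1 / 4 := by
    have : ε ^ α ≤ 1 / (4 * C * K) := by
      calc ε ^ α ≤ ((1 / (4 * C * K)) ^ (1 / α)) ^ α := by
            gcongr; exact min_le_right _ _
        _ = _ := by
          rw [← Real.rpow_mul (by positivity), one_div_mul_cancel hα.ne', Real.rpow_one]
    calc C * ε ^ α * K ≤ C * (1 / (4 * C * K)) * K := by gcongr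
      _ = 1 / 4 := by field_simp
  refine ⟨ε / 2, by positivity, fun ρ hρ hρ1 f hf hf2 => ?_⟩
  have hερ : 0 < ε * ρ := by positivity
  set A := {θ | V θ < ε * ρ} with hA
  have hAm : MeasurableSet A := measurableSet_lt hVm measurable_const
  have hτA : τ.real A ≤ C * (ε ^ α * ρ ^ α) := by
    rw [← Real.mul_rpow hε0.le hρ.le]
    exact h _ hερ (mul_le_one₀ hε1 hρ.le hρ1)
  have hfi : Integrable f τ := L1.integrable_coeFn f
  have hsq : Integrable (fun θ => f θ ^ 2) τ := hf.memLp.integrable_sq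
  have hVf : Integrable (fun θ => V θ * f θ) τ :=
    hfi.bdd_mul hVm.aestronglyMeasurable (c := B) (ae_of_all _ fun θ => by
      rw [Real.norm_of_nonneg (hV0 θ)]; exact hVB θ)
  have hind : Integrable (A.indicator fun _ => K * ρ ^ (-α)) τ :=
    (integrable_const _).indicator hAm
  have hadd : Integrable (fun θ => ρ ^ α / (4 * K) * f θ ^ 2 +
      A.indicator (fun _ => K * ρ ^ (-α)) θ) τ := (hsq.const_mul _).add hind
  -- Off `A`, `V f ≥ ε ρ f`. On `A`, Young's inequality bounds `f` by `ρ ^ α / (4 K) f² + K ρ ^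
  -- (-α)`; each of these two terms will integrate to at most `1 / 4`, so mass at least `1 / 2`
  -- remains off `A`.
  have hle : ∫ θ, (ε * ρ * f θ - ε * ρ * (ρ ^ α / (4 * K) * f θ ^ 2 +
      A.indicator (fun _ => K * ρ ^ (-α)) θ)) ∂τ ≤ ∫ θ, V θ * f θ ∂τ := by
    refine integral_mono_ae ((hfi.const_mul _).sub (hadd.const_mul _)) hVf ?_
    filter_upwards [hf.nonneg] with θ hθ
    simp only [Pi.zero_apply] at hθ
    have h1 : ρ ^ α * ρ ^ (-α) = 1 := by
      rw [← Real.rpow_add hρ, add_neg_cancel, Real.rpow_zero]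
    have hρα : 0 < ρ ^ α := by positivity
    by_cases hθA : θ ∈ A
    · rw [indicator_of_mem hθA]
      have h2 : f θ ≤ ρ ^ α / (4 * K) * f θ ^ 2 + K * ρ ^ (-α) := by
        have h3 : ρ ^ (-α) = (ρ ^ α)⁻¹ := Real.rpow_neg hρ.le _
        rw [h3]
        have h4 : ρ ^ α / (4 * K) * f θ ^ 2 + K * (ρ ^ α)⁻¹ - f θ =
            (ρ ^ α * f θ - 2 * K) ^ 2 / (4 * K * ρ ^ α) := by
          field_simp
          ring
        have h5 : 0 ≤ (ρ ^ α * f θ - 2 * K) ^ 2 / (4 * K * ρ ^ α) := by positivity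
        linarith
      have h6 : 0 ≤ V θ * f θ := mul_nonneg (hV0 θ) hθ
      have h7 := mul_le_mul_of_nonneg_left h2 hερ.le
      linarith
    · rw [indicator_of_notMem hθA]
      have h8 : ε * ρ ≤ V θ := not_lt.1 hθA
      have h9 : 0 ≤ ε * ρ * (ρ ^ α / (4 * K) * f θ ^ 2 + 0) := by positivity
      have h10 := mul_le_mul_of_nonneg_right h8 hθ
      linarith
  have hint : ∫ θ, (ε * ρ * f θ - ε * ρ * (ρ ^ α / (4 * K) * f θ ^ 2 +
      A.indicator (fun _ => K * ρ ^ (-α)) θ)) ∂τ = ε * ρ - ε * ρ * (ρ ^ α / (4 * K) *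
        ∫ θ, f θ ^ 2 ∂τ + τ.real A * (K * ρ ^ (-α))) := by
    rw [integral_sub (hfi.const_mul _) (hadd.const_mul _),
      integral_const_mul, integral_const_mul, hf.integral_eq_one,
      integral_add (hsq.const_mul _) hind, integral_const_mul, integral_indicator_const _ hAm,
      mul_one, smul_eq_mul]
  rw [hint] at hle
  have h1 : ρ ^ α * ρ ^ (-α) = 1 := by
    rw [← Real.rpow_add hρ, add_neg_cancel, Real.rpow_zero]
  have h2 : ρ ^ α / (4 * K) * ∫ θ, f θ ^ 2 ∂τ ≤ 1 / 4 := by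
    calc _ ≤ ρ ^ α / (4 * K) * (K * ρ ^ (-α)) := by gcongr
      _ = (ρ ^ α * ρ ^ (-α)) / 4 := by field_simp
      _ = 1 / 4 := by rw [h1]
  have h3 : τ.real A * (K * ρ ^ (-α)) ≤ 1 / 4 := by
    calc _ ≤ C * (ε ^ α * ρ ^ α) * (K * ρ ^ (-α)) := by gcongr
      _ = C * ε ^ α * K * (ρ ^ α * ρ ^ (-α)) := by ring
      _ ≤ 1 / 4 := by rw [h1, mul_one]; exact hεα
  have h4 := mul_le_mul_of_nonneg_left (add_le_add h2 h3) hερ.le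
  linarith

/-- The normalized indicator of a sublevel set is a density concentrated where `V` is small. -/
theorem exists_isSqDensity_of_le_sublevel [IsProbabilityMeasure τ] {V : Θ → ℝ}
    (hVm : Measurable V) (hV0 : ∀ θ, 0 ≤ V θ) {ρ v : ℝ} (hv : 0 < v)
    (h : v ≤ τ.real {θ | V θ < ρ}) :
    ∃ u : Θ →₁[τ] ℝ, IsSqDensity u ∧ ∫ θ, V θ * u θ ∂τ ≤ ρ ∧ ∫ θ, u θ ^ 2 ∂τ ≤ v⁻¹ := by
  set A := {θ | V θ < ρ} with hA
  have hAm : MeasurableSet A := measurableSet_lt hVm measurable_const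
  have hτA : 0 < τ.real A := hv.trans_le h
  have hmem : ∀ p, MemLp (A.indicator fun _ => (τ.real A)⁻¹) p τ := fun p =>
    (memLp_const _).indicator hAm
  have hae := (hmem 1).coeFn_toLp
  have hsq : ∫ θ, (A.indicator (fun _ => (τ.real A)⁻¹) θ) ^ 2 ∂τ = (τ.real A)⁻¹ := by
    have : (fun θ => (A.indicator (fun _ => (τ.real A)⁻¹) θ) ^ 2) =
        A.indicator (fun _ => (τ.real A)⁻¹ ^ 2) := by
      ext θ
      by_cases hθ : θ ∈ A <;> simp [hθ]
    rw [this, integral_indicator_const _ hAm, smul_eq_mul]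
    field_simp
  have hone : ∫ θ, A.indicator (fun _ => (τ.real A)⁻¹) θ ∂τ = 1 := by
    rw [integral_indicator_const _ hAm, smul_eq_mul, mul_inv_cancel₀ hτA.ne']
  refine ⟨(hmem 1).toLp, ⟨⟨?_, ?_⟩, (hmem 2).ae_eq hae.symm⟩, ?_, ?_⟩
  · filter_upwards [hae] with θ hθ
    rw [hθ]
    exact indicator_nonneg (fun _ _ => by positivity) θ
  · rw [integral_congr_ae hae, hone]
  · have h1 : ∫ θ, V θ * (hmem 1).toLp _ θ ∂τ ≤ ∫ θ, ρ * A.indicator (fun _ => (τ.real A)⁻¹) θ ∂τ := by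
      refine integral_mono_of_nonneg ?_ (((integrable_const _).indicator hAm).const_mul _) ?_
      · filter_upwards [hae] with θ hθ
        rw [hθ]
        exact mul_nonneg (hV0 θ) (indicator_nonneg (fun _ _ => by positivity) θ)
      · filter_upwards [hae] with θ hθ
        rw [hθ]
        by_cases hθA : θ ∈ A
        · simp only [indicator_of_mem hθA]
          have : V θ ≤ ρ := le_of_lt hθA
          gcongr
        · simp [indicator_of_notMem hθA]
    rwa [integral_const_mul, hone, mul_one] at h1
  · have h1 : ∫ θ, (hmem 1).toLp _ θ ^ 2 ∂τ = (τ.real A)⁻¹ :=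
      (integral_congr_ae (hae.mono fun θ hθ => by simp only [hθ])).trans hsq
    refine h1.trans_le ?_
    gcongr

/-- Projection onto a closed convex subset of a Hilbert space, in the form of a three-point
inequality for a linear perturbation. -/
theorem exists_mem_forall_three_point {E : Type*} [NormedAddCommGroup E] [InnerProductSpace ℝ E]
    [CompleteSpace E] {K : Set E} (hne : K.Nonempty) (hclosed : IsClosed K) (hconv : Convex ℝ K)
    (g v : E) (t : ℝ) :
    ∃ h ∈ K, ∀ u ∈ K, ‖u - h‖ ^ 2 + ‖h - g‖ ^ 2 + 2 * t * ⟪v, h⟫_ℝ ≤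
      ‖u - g‖ ^ 2 + 2 * t * ⟪v, u⟫_ℝ := by
  -- Completing the square, `‖u - g‖² + 2 t ⟪v, u⟫` is `‖u - (g - t v)‖²` up to a constant, so its
  -- minimizer is the projection of `g - t v`; the obtuse-angle characterization gives the
  -- three-point form.
  obtain ⟨h, hK, hh⟩ := exists_norm_eq_iInf_of_complete_convex hne hclosed.isComplete hconv
    (g - t • v)
  refine ⟨h, hK, fun u hu => ?_⟩
  have h1 := (norm_eq_iInf_iff_real_inner_le_zero hconv hK).1 hh u hu
  have h2 : ‖u - g‖ ^ 2 = ‖u - h‖ ^ 2 + 2 * ⟪u - h, h - g⟫_ℝ + ‖h - g‖ ^ 2 := by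
    rw [← norm_add_sq_real, sub_add_sub_cancel]
  have h3 : ⟪g - t • v - h, u - h⟫_ℝ = -⟪u - h, h - g⟫_ℝ - t * (⟪v, u⟫_ℝ - ⟪v, h⟫_ℝ) := by
    rw [show g - t • v - h = -(h - g) - t • v by abel, inner_sub_left, inner_neg_left,
      real_inner_smul_left, inner_sub_right v, real_inner_comm]
  rw [h3] at h1
  linarith

theorem norm_sq_eq_integral_sq (f : Lp ℝ 2 τ) : ‖f‖ ^ 2 = ∫ θ, f θ ^ 2 ∂τ := by
  rw [← real_inner_self_eq_norm_sq, L2.inner_def]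
  exact integral_congr_ae (ae_of_all _ fun θ => by simp [sq])

/-- Existence of the proximal step for square-integrable densities, with its three-point
inequality. -/
theorem exists_isSqDensity_forall_three_point [IsProbabilityMeasure τ] {V : Θ → ℝ}
    (hV : MemLp V 2 τ) {g : Θ →₁[τ] ℝ} (hg : IsSqDensity g) (t : ℝ) :
    ∃ h : Θ →₁[τ] ℝ, IsSqDensity h ∧ ∀ u : Θ →₁[τ] ℝ, IsSqDensity u →
      ∫ θ, (u θ - h θ) ^ 2 ∂τ + ∫ θ, (h θ - g θ) ^ 2 ∂τ + 2 * t * ∫ θ, V θ * h θ ∂τ ≤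
        ∫ θ, (u θ - g θ) ^ 2 ∂τ + 2 * t * ∫ θ, V θ * u θ ∂τ := by
  let one : Lp ℝ 2 τ := (memLp_const (1 : ℝ)).toLp
  have hone : ∀ f : Lp ℝ 2 τ, ⟪one, f⟫_ℝ = ∫ θ, f θ ∂τ := by
    intro f
    rw [L2.inner_def]
    exact integral_congr_ae (ae_of_all _ fun θ => by simp [one])
  let K : Set (Lp ℝ 2 τ) := {f | 0 ≤ f} ∩ {f | ⟪one, f⟫_ℝ = 1}
  have hKc : IsClosed K := isClosed_Ici.inter
    (isClosed_eq (continuous_const.inner continuous_id) continuous_const)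
  have hKconv : Convex ℝ K := by
    refine Convex.inter (fun f hf g hg a b ha hb _ => ?_) ?_
    · change 0 ≤ a • f + b • g
      rw [← Lp.coeFn_nonneg]
      filter_upwards [(Lp.coeFn_nonneg f).2 hf, (Lp.coeFn_nonneg g).2 hg,
        Lp.coeFn_add (a • f) (b • g), Lp.coeFn_smul a f, Lp.coeFn_smul b g] with θ h1 h2 h3 h4 h5
      rw [h3, Pi.add_apply, h4, h5, Pi.smul_apply, Pi.smul_apply]
      exact add_nonneg (smul_nonneg ha h1) (smul_nonneg hb h2)
    · exact (convex_singleton (1 : ℝ)).linear_preimage (innerₛₗ ℝ one)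
  have hmemK : ∀ u : Θ →₁[τ] ℝ, ∀ hu : IsSqDensity u, hu.memLp.toLp ∈ K := by
    intro u hu
    refine ⟨?_, ?_⟩
    · change 0 ≤ hu.memLp.toLp
      rw [← Lp.coeFn_nonneg]
      exact hu.nonneg.trans_eq hu.memLp.coeFn_toLp.symm
    · change ⟪one, hu.memLp.toLp⟫_ℝ = 1
      rw [hone, integral_congr_ae hu.memLp.coeFn_toLp, hu.integral_eq_one]
  have hinner : ∀ (w : Lp ℝ 2 τ) (w' : Θ → ℝ), w =ᵐ[τ] w' →
      ⟪hV.toLp, w⟫_ℝ = ∫ θ, V θ * w' θ ∂τ := by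
    intro w w' hw
    rw [L2.inner_def]
    refine integral_congr_ae ?_
    filter_upwards [hV.coeFn_toLp, hw] with θ h1 h2
    simp [h1, h2, mul_comm]
  have hdist : ∀ (w z : Lp ℝ 2 τ) (w' z' : Θ → ℝ), w =ᵐ[τ] w' → z =ᵐ[τ] z' →
      ‖w - z‖ ^ 2 = ∫ θ, (w' θ - z' θ) ^ 2 ∂τ := by
    intro w z w' z' hw hz
    rw [norm_sq_eq_integral_sq]
    refine integral_congr_ae ?_
    filter_upwards [Lp.coeFn_sub w z, hw, hz] with θ h1 h2 h3
    rw [h1, Pi.sub_apply, h2, h3]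
  obtain ⟨h, hhK, hh⟩ := exists_mem_forall_three_point ⟨_, hmemK g hg⟩ hKc hKconv
    hg.memLp.toLp hV.toLp t
  have hm1 : MemLp h 1 τ := (Lp.memLp h).mono_exponent (by norm_num)
  have hae := hm1.coeFn_toLp
  refine ⟨hm1.toLp, ⟨⟨?_, ?_⟩, (Lp.memLp h).ae_eq hae.symm⟩, fun u hu => ?_⟩
  · exact ((Lp.coeFn_nonneg h).2 hhK.1).trans_eq hae.symm
  · rw [integral_congr_ae hae, ← hone]
    exact hhK.2
  · have := hh _ (hmemK u hu)
    rwa [hdist _ _ u _ hu.memLp.coeFn_toLp hae.symm, hdist _ _ _ g hae.symm hg.memLp.coeFn_toLp,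
      hdist _ _ u g hu.memLp.coeFn_toLp hg.memLp.coeFn_toLp, hinner _ _ hae.symm,
      hinner _ _ hu.memLp.coeFn_toLp] at this

end Densities

/-! ### Real sequences: growth of the squared norms -/

section Rates

/-- Summation of the three-point inequalities of a proximal method. -/
theorem add_two_mul_sum_le_of_forall_le {a e m t : ℕ → ℝ} {M : ℝ} (he : ∀ k, 0 ≤ e k)
    (h : ∀ k, a (k + 1) + e k + 2 * t k * m (k + 1) ≤ a k + 2 * t k * M) (k : ℕ) :
    a k + 2 * ∑ j ∈ Finset.range k, t j * m (j + 1) ≤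
      a 0 + 2 * (M * ∑ j ∈ Finset.range k, t j) := by
  induction k with
  | zero => simp
  | succ k ih =>
    rw [Finset.sum_range_succ, Finset.sum_range_succ]
    have := h k
    have := he k
    nlinarith

/-- The choice `ρ = k ^ (-1 / (α + β))` balances the cost `ρ ^ (-α)` of the competitor against the
accumulated error `k ρ ^ β`. -/
theorem rpow_scale_neg {α β : ℝ} (hαβ : 0 < α + β) {k : ℕ} (hk : 1 ≤ k) :
    ((k : ℝ) ^ (-1 / (α + β))) ^ (-α) = k * ((k : ℝ) ^ (-1 / (α + β))) ^ β := by
  have hk0 : (0 : ℝ) < k := by exact_mod_cast hk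
  rw [← Real.rpow_mul hk0.le, ← Real.rpow_mul hk0.le]
  nth_rw 2 [← Real.rpow_one (k : ℝ)]
  rw [← Real.rpow_add hk0]
  congr 1
  field_simp
  ring

/-- Bound on the squared norms of the iterates for a linear smooth part. -/
theorem exists_forall_le_mul_rpow_of_linear {N m : ℕ → ℝ} {s α A : ℝ} (hs : 0 < s) (hα : 0 < α)
    (hA : 0 < A) (hm : ∀ k, 0 ≤ m k)
    (h : ∀ ρ : ℝ, 0 < ρ → ρ ≤ 1 → ∀ k : ℕ,
      N k + 4 * s * ∑ j ∈ Finset.range k, m (j + 1) ≤ A * ρ ^ (-α) + 4 * s * (ρ * k)) :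
    ∃ K : ℝ, 0 < K ∧ ∀ k : ℕ, 1 ≤ k →
      N k ≤ K * ((k : ℝ) ^ (-1 / (α + 1))) ^ (-α) := by
  refine ⟨A + 4 * s, by positivity, fun k hk => ?_⟩
  have hk1 : (1 : ℝ) ≤ k := by exact_mod_cast hk
  have h1 := h ((k : ℝ) ^ (-1 / (α + 1))) (by positivity)
    (Real.rpow_le_one_of_one_le_of_nonpos hk1 (by
      rw [neg_div]; exact neg_nonpos.2 (by positivity))) k
  have h2 := rpow_scale_neg (α := α) (β := 1) (by positivity) hk
  rw [Real.rpow_one] at h2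
  have h3 : 0 ≤ 4 * s * ∑ j ∈ Finset.range k, m (j + 1) :=
    mul_nonneg (by positivity) (Finset.sum_nonneg fun j _ => hm _)
  rw [mul_comm _ (k : ℝ), ← h2] at h1
  linarith

/-- Bound on the squared norms of the iterates for a quadratic smooth part. -/
theorem exists_forall_le_mul_rpow_of_quadratic {N m : ℕ → ℝ} {s α A : ℝ} (hs : 0 < s) (hα : 0 < α)
    (hA : 0 < A) (hN : ∀ k, 0 ≤ N k) (hm : ∀ k, 0 ≤ m k) (hanti : ∀ k, m (k + 1) ≤ m k)
    (h : ∀ ρ : ℝ, 0 < ρ → ρ ≤ 1 → ∀ k : ℕ,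
      N k + 4 * s * ∑ j ∈ Finset.range k, m j * m (j + 1) ≤
        A * ρ ^ (-α) + 4 * s * (ρ * ∑ j ∈ Finset.range k, m j)) :
    ∃ K : ℝ, 0 < K ∧ ∀ k : ℕ, 1 ≤ k →
      N k ≤ K * ((k : ℝ) ^ (-1 / (α + 2))) ^ (-α) := by
  set B : ℝ := A / (4 * s) + m 0 with hB
  have hm0 := hm 0
  have hB0 : 0 ≤ B := by positivity
  refine ⟨A + 4 * s * (m 0 + B + 1), by positivity, fun k hk => ?_⟩
  have hk1 : (1 : ℝ) ≤ k := by exact_mod_cast hk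
  set ρ : ℝ := (k : ℝ) ^ (-1 / (α + 2)) with hρ
  have hρ0 : 0 < ρ := by positivity
  have h1 := h ρ hρ0 (Real.rpow_le_one_of_one_le_of_nonpos hk1 (by
      rw [neg_div]; exact neg_nonpos.2 (by positivity))) k
  have h2 : ρ ^ (-α) = k * ρ ^ 2 := by
    have := rpow_scale_neg (α := α) (β := 2) (by positivity) hk
    rwa [Real.rpow_two] at this
  set X : ℝ := k * ρ with hX
  -- Since `X ≥ 1`, the boundary term `m 0 * X` can be absorbed into `m 0 * X ^ 2`.
  have hX1 : 1 ≤ X := by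
    have : X = (k : ℝ) ^ (1 + -1 / (α + 2)) := by
      rw [Real.rpow_add (by positivity), Real.rpow_one]
    rw [this]
    refine Real.one_le_rpow hk1 ?_
    rw [neg_div, ← sub_eq_add_neg, sub_nonneg, div_le_one (by positivity)]
    linarith
  set S := ∑ j ∈ Finset.range k, m (j + 1) with hS
  have hS0 : 0 ≤ S := Finset.sum_nonneg fun j _ => hm _
  have hsum : ∑ j ∈ Finset.range k, m j ≤ m 0 + S := by
    have h3 : ∑ j ∈ Finset.range k, m j ≤ ∑ j ∈ Finset.range (k + 1), m j :=
      Finset.sum_le_sum_of_subset_of_nonneg (Finset.range_mono (Nat.le_succ k)) fun j _ _ => hm j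
    rw [Finset.sum_range_succ'] at h3
    linarith
  -- Cauchy–Schwarz and the monotonicity of `m` bound `S ^ 2` by `k` times the sum of products that
  -- the energy estimate controls.
  have hcs : S ^ 2 ≤ k * ∑ j ∈ Finset.range k, m (j + 1) ^ 2 := by
    simpa using sq_sum_le_card_mul_sum_sq (s := Finset.range k) (f := fun j => m (j + 1))
  have hsq : ∑ j ∈ Finset.range k, m (j + 1) ^ 2 ≤ ∑ j ∈ Finset.range k, m j * m (j + 1) := by
    refine Finset.sum_le_sum fun j _ => ?_
    rw [sq]
    exact mul_le_mul_of_nonneg_right (hanti j) (hm _)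
  have h4 : ∑ j ∈ Finset.range k, m j * m (j + 1) ≤
      A / (4 * s) * (k * ρ ^ 2) + ρ * (m 0 + S) := by
    have h5 : 4 * s * ∑ j ∈ Finset.range k, m j * m (j + 1) ≤
        4 * s * (A / (4 * s) * (k * ρ ^ 2) + ρ * (m 0 + S)) := by
      have h6 : 4 * s * (ρ * ∑ j ∈ Finset.range k, m j) ≤ 4 * s * (ρ * (m 0 + S)) := by gcongr
      have h7 : 4 * s * (A / (4 * s) * (k * ρ ^ 2)) = A * (k * ρ ^ 2) := by field_simp
      rw [h2] at h1
      have := hN k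
      rw [mul_add, h7]
      linarith
    exact le_of_mul_le_mul_left h5 (by positivity)
  have h8 : S ^ 2 ≤ B * X ^ 2 + X * S := by
    have h9 : S ^ 2 ≤ k * (A / (4 * s) * (k * ρ ^ 2) + ρ * (m 0 + S)) :=
      hcs.trans (by gcongr; exact hsq.trans h4)
    have h10 : k * (A / (4 * s) * (k * ρ ^ 2) + ρ * (m 0 + S)) =
        A / (4 * s) * X ^ 2 + X * m 0 + X * S := by rw [hX]; ring
    have h11 : X * m 0 ≤ X ^ 2 * m 0 := by
      gcongr
      nlinarith
    rw [hB]
    linarith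
  have h12 : S ≤ (B + 1) * X := by
    by_contra! hlt
    have hXS : X ≤ S := by nlinarith
    have h13 : B * X ^ 2 ≤ B * X * S := by
      rw [sq, ← mul_assoc]; gcongr
    nlinarith
  have h14 : ρ * ∑ j ∈ Finset.range k, m j ≤ (m 0 + B + 1) * ρ ^ (-α) := by
    have h15 : ∑ j ∈ Finset.range k, m j ≤ (m 0 + B + 1) * X := by nlinarith
    calc _ ≤ ρ * ((m 0 + B + 1) * X) := by gcongr
      _ = _ := by rw [h2, hX]; ring
  have h16 : 0 ≤ 4 * s * ∑ j ∈ Finset.range k, m j * m (j + 1) :=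
    mul_nonneg (by positivity) (Finset.sum_nonneg fun j _ => mul_nonneg (hm _) (hm _))
  have h17 := mul_le_mul_of_nonneg_left h14 (show 0 ≤ 4 * s by positivity)
  linarith

end Rates
-- Objectives with a scalar feature map and their proximal steps
section ScalarObjective
open Filter
open scoped Topology

theorem powerEta_two (x : ℝ) : powerEta 2 x = x ^ 2 / 2 := by
  simp only [powerEta, Real.rpow_two, sq_abs]
  norm_num

theorem bregman_powerEta_two (a b : ℝ) : bregman (powerEta 2) a b = (a - b) ^ 2 / 2 := by
  have h : powerEta 2 = fun x => x ^ 2 / 2 := funext powerEta_two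
  have hd : HasDerivAt (fun x : ℝ => x ^ 2 / 2) b b := by
    simpa using (hasDerivAt_pow 2 b).div_const 2
  rw [bregman, h, hd.deriv]
  ring

section Measure

variable {Θ : Type*} [MeasurableSpace Θ] {τ : Measure Θ}

theorem nonneg_withDensityᵥ_iff (f : Θ →₁[τ] ℝ) : 0 ≤ τ.withDensityᵥ f ↔ 0 ≤ᵐ[τ] f := by
  have hf : Integrable f τ := L1.integrable_coeFn f
  refine ⟨fun h => ae_nonneg_of_forall_setIntegral_nonneg hf fun s hs _ => ?_, fun h => ?_⟩
  · have := h s hs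
    rwa [withDensityᵥ_apply hf hs] at this
  · intro s hs
    rw [withDensityᵥ_apply hf hs]
    exact setIntegral_nonneg_of_ae h

theorem isDensity_iff (f : Θ →₁[τ] ℝ) :
    IsDensity f ↔ 0 ≤ τ.withDensityᵥ f ∧ τ.withDensityᵥ f univ = 1 := by
  rw [nonneg_withDensityᵥ_iff, withDensityᵥ_apply (L1.integrable_coeFn f) MeasurableSet.univ,
    setIntegral_univ]
  exact ⟨fun h => ⟨h.1, h.2⟩, fun h => ⟨h.1, h.2⟩⟩

/-- For nonnegative `f`, the signed measure `f τ` comes from a finite positive measure, which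
reduces the vector-measure integral to a Bochner integral. -/
theorem vectorMeasure_integral_withDensityᵥ {f : Θ →₁[τ] ℝ} (hf : 0 ≤ᵐ[τ] f) (V : Θ → ℝ) :
    ∫ᵛ θ, V θ ∂<•(τ.withDensityᵥ f) = ∫ θ, V θ * f θ ∂τ := by
  have hfi : Integrable f τ := L1.integrable_coeFn f
  have hm : AEMeasurable (fun θ => ENNReal.ofReal (f θ)) τ := hfi.aemeasurable.ennreal_ofReal
  have hfin : ∫⁻ θ, ENNReal.ofReal (f θ) ∂τ ≠ ⊤ :=
    (hasFiniteIntegral_iff_ofReal hf).1 hfi.2 |>.ne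
  have : IsFiniteMeasure (τ.withDensity fun θ => ENNReal.ofReal (f θ)) :=
    isFiniteMeasure_withDensity hfin
  have hae : (f : Θ → ℝ) =ᵐ[τ] fun θ => (ENNReal.ofReal (f θ)).toReal := by
    filter_upwards [hf] with θ hθ
    rw [ENNReal.toReal_ofReal hθ]
  rw [WithDensityᵥEq.congr_ae hae, withDensityᵥ_toReal hm hfin,
    VectorMeasure.integral_toSignedMeasure,
    integral_withDensity_eq_integral_toReal_smul₀ hm (ae_of_all _ fun _ => ENNReal.ofReal_lt_top)]
  refine integral_congr_ae ?_
  filter_upwards [hf] with θ hθ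
  rw [ENNReal.toReal_ofReal hθ, smul_eq_mul, mul_comm]

theorem vectorMeasure_integral_nonneg {ν : SignedMeasure Θ} (hν : 0 ≤ ν) {V : Θ → ℝ}
    (hV : ∀ θ, 0 ≤ V θ) : 0 ≤ ∫ᵛ θ, V θ ∂<•ν := by
  have h := (VectorMeasure.le_restrict_univ_iff_le 0 ν).2 hν
  rw [← SignedMeasure.toMeasureOfZeroLE_toSignedMeasure ν h,
    VectorMeasure.integral_toSignedMeasure]
  exact integral_nonneg hV

theorem bregmanInt_powerEta_two_of_memLp {f g : Θ →₁[τ] ℝ} (h : MemLp (fun θ => f θ - g θ) 2 τ) :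
    bregmanInt (powerEta 2) τ f g = ENNReal.ofReal ((∫ θ, (f θ - g θ) ^ 2 ∂τ) / 2) := by
  simp only [bregmanInt, bregman_powerEta_two]
  rw [← integral_div, ofReal_integral_eq_lintegral_ofReal (h.integrable_sq.div_const 2)
    (ae_of_all _ fun θ => by positivity)]

theorem memLp_of_bregmanInt_powerEta_two_ne_top {f g : Θ →₁[τ] ℝ}
    (h : bregmanInt (powerEta 2) τ f g ≠ ⊤) : MemLp (fun θ => f θ - g θ) 2 τ := by
  have hm : AEStronglyMeasurable (fun θ => f θ - g θ) τ :=
    (Lp.aestronglyMeasurable f).sub (Lp.aestronglyMeasurable g)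
  rw [memLp_two_iff_integrable_sq hm]
  simp only [bregmanInt, bregman_powerEta_two] at h
  have hi : Integrable (fun θ => (f θ - g θ) ^ 2 / 2) τ := by
    refine ⟨(hm.pow 2).aemeasurable.div_const 2 |>.aestronglyMeasurable, ?_⟩
    rw [hasFiniteIntegral_iff_ofReal (ae_of_all _ fun θ => by positivity)]
    exact h.lt_top
  simpa using hi.mul_const 2

theorem integral_sq_le_two_mul_add {f g : Θ → ℝ} (hf : MemLp f 2 τ) (hg : MemLp g 2 τ) :
    ∫ θ, f θ ^ 2 ∂τ ≤ 2 * ∫ θ, (g θ - f θ) ^ 2 ∂τ + 2 * ∫ θ, g θ ^ 2 ∂τ := by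
  have h1 : Integrable (fun θ => (g θ - f θ) ^ 2) τ := (hg.sub hf).integrable_sq
  rw [← integral_const_mul, ← integral_const_mul,
    ← integral_add (h1.const_mul 2) (hg.integrable_sq.const_mul 2)]
  refine integral_mono hf.integrable_sq ((h1.const_mul 2).add (hg.integrable_sq.const_mul 2))
    fun θ => ?_
  simp only
  nlinarith [sq_nonneg (2 * g θ - f θ)]

theorem integral_sub_sq_le_two_mul_add {f g : Θ → ℝ} (hf : MemLp f 2 τ) (hg : MemLp g 2 τ) :
    ∫ θ, (g θ - f θ) ^ 2 ∂τ ≤ 2 * ∫ θ, g θ ^ 2 ∂τ + 2 * ∫ θ, f θ ^ 2 ∂τ := by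
  rw [← integral_const_mul, ← integral_const_mul,
    ← integral_add (hg.integrable_sq.const_mul 2) (hf.integrable_sq.const_mul 2)]
  refine integral_mono (hg.sub hf).integrable_sq
    ((hg.integrable_sq.const_mul 2).add (hf.integrable_sq.const_mul 2)) fun θ => ?_
  simp only
  nlinarith [sq_nonneg (g θ + f θ)]

theorem isSqDensity_const_one [IsProbabilityMeasure τ] : IsSqDensity (Lp.const 1 τ (1 : ℝ)) := by
  have h := Lp.coeFn_const 1 τ (1 : ℝ)
  refine ⟨⟨?_, ?_⟩, (memLp_const (1 : ℝ)).ae_eq h.symm⟩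
  · filter_upwards [h] with θ hθ
    rw [hθ]
    exact zero_le_one
  · rw [integral_congr_ae h]
    simp

end Measure

variable {Θ : Type*} [TopologicalSpace Θ]

/-- The objective `R (∫ V dμ)` on probability measures, for scalar `V` and `R`. -/
def scalarObjective (V : C(Θ, ℝ)) (R : ℝ → ℝ) (hR : ConvexOn ℝ univ R) (hR' : Differentiable ℝ R)
    (hlip : ∃ K : ℝ≥0, LipschitzWith K (gradient R)) : Objective Θ where
  𝓕 := ℝ
  Φ := V
  R := R
  convexOn_R := hR
  differentiable_R := hR'
  lipschitz_gradient_R := hlip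
  lam := 0
  regularizers := [Regularizer.prob]

variable [MeasurableSpace Θ] {V : C(Θ, ℝ)} {R : ℝ → ℝ} {hR : ConvexOn ℝ univ R}
  {hR' : Differentiable ℝ R} {hlip : ∃ K : ℝ≥0, LipschitzWith K (gradient R)} {τ : Measure Θ}

theorem scalarObjective_Hbar_of_prob {ν : SignedMeasure Θ} (h : 0 ≤ ν ∧ ν univ = 1) :
    (scalarObjective V R hR hR' hlip).Hbar ν = 0 := by
  simp [scalarObjective, Objective.Hbar, Regularizer.eval, h]

theorem scalarObjective_Hbar_of_not_prob {ν : SignedMeasure Θ} (h : ¬(0 ≤ ν ∧ ν univ = 1)) :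
    (scalarObjective V R hR hR' hlip).Hbar ν = ⊤ := by
  simp only [scalarObjective, Objective.Hbar, List.map_cons, List.map_nil, List.sum_cons,
    List.sum_nil, add_zero, Regularizer.eval]
  rw [if_neg h]

theorem scalarObjective_Gbar (ν : SignedMeasure Θ) :
    (scalarObjective V R hR hR' hlip).Gbar ν = R (∫ᵛ θ, V θ ∂<•ν) := rfl

theorem scalarObjective_GbarDeriv (ν : SignedMeasure Θ) (θ : Θ) :
    (scalarObjective V R hR hR' hlip).GbarDeriv ν θ = deriv R (∫ᵛ θ, V θ ∂<•ν) * V θ := by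
  have : (scalarObjective V R hR hR' hlip).GbarDeriv ν θ =
      ⟪gradient R (∫ᵛ θ, V θ ∂<•ν), V θ⟫_ℝ := rfl
  rw [this, gradient_eq_deriv']
  simp [mul_comm]

theorem scalarObjective_H_of_isDensity {f : Θ →₁[τ] ℝ} (hf : IsDensity f) :
    (scalarObjective V R hR hR' hlip).H τ f = 0 :=
  scalarObjective_Hbar_of_prob ((isDensity_iff f).1 hf)

theorem scalarObjective_G {f : Θ →₁[τ] ℝ} (hf : IsDensity f) :
    (scalarObjective V R hR hR' hlip).G τ f = R (∫ θ, V θ * f θ ∂τ) := by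
  rw [Objective.G, scalarObjective_Gbar, vectorMeasure_integral_withDensityᵥ hf.nonneg]

theorem scalarObjective_GDeriv {f : Θ →₁[τ] ℝ} (hf : IsDensity f) (θ : Θ) :
    (scalarObjective V R hR hR' hlip).GDeriv τ f θ = deriv R (∫ θ, V θ * f θ ∂τ) * V θ := by
  rw [Objective.GDeriv, scalarObjective_GbarDeriv, vectorMeasure_integral_withDensityᵥ hf.nonneg]

theorem scalarObjective_F {f : Θ →₁[τ] ℝ} (hf : IsDensity f) :
    (scalarObjective V R hR hR' hlip).F τ f = (R (∫ θ, V θ * f θ ∂τ) : ℝ) := by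
  have h1 := scalarObjective_G (V := V) (R := R) (hR := hR) (hR' := hR') (hlip := hlip) hf
  have h2 := scalarObjective_H_of_isDensity (V := V) (R := R) (hR := hR) (hR' := hR')
    (hlip := hlip) hf
  rw [Objective.G] at h1
  rw [Objective.H] at h2
  rw [Objective.F, Objective.Fbar, h1, h2]
  simp

theorem scalarObjective_Fbar_nonneg (hV : ∀ θ, 0 ≤ V θ) (hR0 : ∀ x, 0 ≤ x → 0 ≤ R x)
    (ν : SignedMeasure Θ) : 0 ≤ (scalarObjective V R hR hR' hlip).Fbar ν := by
  by_cases h : 0 ≤ ν ∧ ν univ = 1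
  · rw [Objective.Fbar, scalarObjective_Hbar_of_prob h, scalarObjective_Gbar]
    have := hR0 _ (vectorMeasure_integral_nonneg h.1 hV)
    simpa using this
  · rw [Objective.Fbar, scalarObjective_Hbar_of_not_prob h]
    simp

/-- Non-densities make `H` infinite and `f - g ∉ L²` makes the Bregman term infinite, so the
minimization over `L¹` takes place in the Hilbert space `L²`. -/
theorem isSqDensity_of_pgmStep_ne_top {s : ℝ} (hs : 0 < s) {f g : Θ →₁[τ] ℝ} (hg : IsSqDensity g)
    (h : (scalarObjective V R hR hR' hlip).pgmStep τ (powerEta 2) s g f ≠ ⊤) : IsSqDensity f := by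
  have h1 : IsDensity f := by
    by_contra hf
    apply h
    rw [Objective.pgmStep, Objective.H,
      scalarObjective_Hbar_of_not_prob (mt (isDensity_iff f).2 hf)]
    rw [EReal.coe_ennreal_top, EReal.coe_add_top, EReal.top_add_of_ne_bot]
    exact EReal.coe_ennreal_ne_bot _
  refine ⟨h1, ?_⟩
  have h2 : bregmanInt (powerEta 2) τ f g ≠ ⊤ := by
    intro h2
    apply h
    rw [Objective.pgmStep, h2, scalarObjective_H_of_isDensity h1, ENNReal.mul_top,
      EReal.coe_ennreal_top, EReal.add_top_of_ne_bot]
    · simp [EReal.add_eq_bot_iff]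
    · simpa using hs
  have := (memLp_of_bregmanInt_powerEta_two_ne_top h2).add hg.memLp
  refine this.ae_eq (ae_of_all _ fun θ => ?_)
  simp

variable [CompactSpace Θ] [BorelSpace Θ]

theorem ContinuousMap.integrable_mul_L1 (V : C(Θ, ℝ)) (f : Θ →₁[τ] ℝ) :
    Integrable (fun θ => V θ * f θ) τ :=
  (L1.integrable_coeFn f).bdd_mul V.continuous.measurable.aestronglyMeasurable (c := ‖V‖)
    (ae_of_all _ V.norm_coe_le_norm)

theorem scalarObjective_pgmStep {s : ℝ} (hs : 0 < s) {f g : Θ →₁[τ] ℝ} (hf : IsSqDensity f)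
    (hg : IsSqDensity g) :
    (scalarObjective V R hR hR' hlip).pgmStep τ (powerEta 2) s g f =
      (R (∫ θ, V θ * g θ ∂τ) + deriv R (∫ θ, V θ * g θ ∂τ) *
        (∫ θ, V θ * f θ ∂τ - ∫ θ, V θ * g θ ∂τ) + (∫ θ, (f θ - g θ) ^ 2 ∂τ) / (2 * s) : ℝ) := by
  have hfg : MemLp (fun θ => f θ - g θ) 2 τ := hf.memLp.sub hg.memLp
  have h1 : ∫ θ, deriv R (∫ θ, V θ * g θ ∂τ) * V θ * (f θ - g θ) ∂τ =
      deriv R (∫ θ, V θ * g θ ∂τ) * (∫ θ, V θ * f θ ∂τ - ∫ θ, V θ * g θ ∂τ) := by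
    rw [← integral_sub (V.integrable_mul_L1 f) (V.integrable_mul_L1 g), ← integral_const_mul]
    refine integral_congr_ae (ae_of_all _ fun θ => ?_)
    simp only
    ring
  have h2 : (0 : ℝ) ≤ ∫ θ, (f θ - g θ) ^ 2 ∂τ := integral_nonneg fun θ => by positivity
  rw [Objective.pgmStep, scalarObjective_G hg.toIsDensity,
    scalarObjective_H_of_isDensity hf.toIsDensity, bregmanInt_powerEta_two_of_memLp hfg]
  simp_rw [scalarObjective_GDeriv hg.toIsDensity]
  rw [h1, ← ENNReal.ofReal_mul (by positivity), EReal.coe_ennreal_ofReal,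
    max_eq_left (by positivity), EReal.coe_ennreal_zero, add_zero, ← EReal.coe_add]
  congr 2
  field_simp

variable [IsProbabilityMeasure τ]

theorem ContinuousMap.memLp_of_isFiniteMeasure (V : C(Θ, ℝ)) (p : ℝ≥0∞) : MemLp V p τ := by
  refine MemLp.of_bound V.continuous.measurable.aestronglyMeasurable ‖V‖ (ae_of_all _ fun θ => ?_)
  exact V.norm_coe_le_norm θ

/-- One step of the proximal gradient method from a square-integrable density has a unique
minimizer, which satisfies a three-point inequality. -/
theorem exists_isSqDensity_forall_isMinOn_pgmStep_iff {s : ℝ} (hs : 0 < s) {g : Θ →₁[τ] ℝ}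
    (hg : IsSqDensity g) :
    ∃ h : Θ →₁[τ] ℝ, IsSqDensity h ∧ (∀ u : Θ →₁[τ] ℝ, IsSqDensity u →
      ∫ θ, (u θ - h θ) ^ 2 ∂τ + ∫ θ, (h θ - g θ) ^ 2 ∂τ +
        2 * (s * deriv R (∫ θ, V θ * g θ ∂τ)) * ∫ θ, V θ * h θ ∂τ ≤
        ∫ θ, (u θ - g θ) ^ 2 ∂τ + 2 * (s * deriv R (∫ θ, V θ * g θ ∂τ)) * ∫ θ, V θ * u θ ∂τ) ∧
      ∀ f : Θ →₁[τ] ℝ, IsMinOn ((scalarObjective V R hR hR' hlip).pgmStep τ (powerEta 2) s g)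
        univ f ↔ f = h := by
  obtain ⟨h, hh, h3⟩ := exists_isSqDensity_forall_three_point
    (V.memLp_of_isFiniteMeasure (τ := τ) 2) hg (s * deriv R (∫ θ, V θ * g θ ∂τ))
  refine ⟨h, hh, h3, fun f => ⟨fun hf => ?_, ?_⟩⟩
  · have hle : (scalarObjective V R hR hR' hlip).pgmStep τ (powerEta 2) s g f ≤
        (scalarObjective V R hR hR' hlip).pgmStep τ (powerEta 2) s g h := hf (mem_univ h)
    have hfs : IsSqDensity f := by
      refine isSqDensity_of_pgmStep_ne_top (V := V) (R := R) (hR := hR) (hR' := hR')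
        (hlip := hlip) hs hg fun htop => ?_
      rw [htop, scalarObjective_pgmStep hs hh hg, top_le_iff] at hle
      exact EReal.coe_ne_top _ hle
    rw [scalarObjective_pgmStep hs hh hg, scalarObjective_pgmStep hs hfs hg,
      EReal.coe_le_coe_iff] at hle
    -- The three-point inequality tested at another minimizer `f` leaves `∫ (f - h)² ≤ 0`.
    have h4 := h3 f hfs
    set w := deriv R (∫ θ, V θ * g θ ∂τ)
    have h5 : ∫ θ, (f θ - g θ) ^ 2 ∂τ + 2 * (s * w) * ∫ θ, V θ * f θ ∂τ ≤
        ∫ θ, (h θ - g θ) ^ 2 ∂τ + 2 * (s * w) * ∫ θ, V θ * h θ ∂τ := by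
      have h6 : w * ∫ θ, V θ * f θ ∂τ + (∫ θ, (f θ - g θ) ^ 2 ∂τ) / (2 * s) ≤
          w * ∫ θ, V θ * h θ ∂τ + (∫ θ, (h θ - g θ) ^ 2 ∂τ) / (2 * s) := by linarith
      have h7 := mul_le_mul_of_nonneg_left h6 (show 0 ≤ 2 * s by positivity)
      rw [mul_add, mul_add, mul_div_cancel₀ _ (by positivity),
        mul_div_cancel₀ _ (by positivity)] at h7
      linarith
    have h8 : ∫ θ, (f θ - h θ) ^ 2 ∂τ = 0 :=
      le_antisymm (by linarith) (integral_nonneg fun θ => by positivity)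
    have h9 : Integrable (fun θ => (f θ - h θ) ^ 2) τ := (hfs.memLp.sub hh.memLp).integrable_sq
    rw [integral_eq_zero_iff_of_nonneg (fun θ => by positivity) h9] at h8
    refine Lp.ext ?_
    filter_upwards [h8] with θ hθ
    simpa [sub_eq_zero] using hθ
  · rintro rfl u -
    by_cases hu : IsSqDensity u
    · simp only [mem_ofPred_eq]
      rw [scalarObjective_pgmStep hs hh hg, scalarObjective_pgmStep hs hu hg,
        EReal.coe_le_coe_iff]
      have h4 := h3 u hu
      set w := deriv R (∫ θ, V θ * g θ ∂τ)
      have h5 : (0 : ℝ) ≤ ∫ θ, (u θ - f θ) ^ 2 ∂τ := integral_nonneg fun θ => by positivity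
      have h6 : (∫ θ, (f θ - g θ) ^ 2 ∂τ) / (2 * s) + w * ∫ θ, V θ * f θ ∂τ ≤
          (∫ θ, (u θ - g θ) ^ 2 ∂τ) / (2 * s) + w * ∫ θ, V θ * u θ ∂τ := by
        refine le_of_mul_le_mul_left ?_ (show 0 < 2 * s by positivity)
        rw [mul_add, mul_add, mul_div_cancel₀ _ (by positivity),
          mul_div_cancel₀ _ (by positivity)]
        linarith
      linarith
    · have : (scalarObjective V R hR hR' hlip).pgmStep τ (powerEta 2) s g u = ⊤ := by
        by_contra hne
        exact hu (isSqDensity_of_pgmStep_ne_top hs hg hne)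
      simp only [mem_ofPred_eq, this, le_top]

/-- The iterates of the proximal gradient method from the constant density exist, are unique, and
satisfy three-point inequalities. -/
theorem existsUnique_isPGM {s : ℝ} (hs : 0 < s) :
    ∃ f : ℕ → (Θ →₁[τ] ℝ), (∀ f' : ℕ → (Θ →₁[τ] ℝ), (scalarObjective V R hR hR' hlip).IsPGM τ
      (powerEta 2) s (Lp.const 1 τ (1 : ℝ)) f' ↔ f' = f) ∧ f 0 = Lp.const 1 τ (1 : ℝ) ∧
      (∀ k, IsSqDensity (f k)) ∧ ∀ k, ∀ u : Θ →₁[τ] ℝ, IsSqDensity u →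
      ∫ θ, (u θ - f (k + 1) θ) ^ 2 ∂τ + ∫ θ, (f (k + 1) θ - f k θ) ^ 2 ∂τ +
        2 * (s * deriv R (∫ θ, V θ * f k θ ∂τ)) * ∫ θ, V θ * f (k + 1) θ ∂τ ≤
        ∫ θ, (u θ - f k θ) ^ 2 ∂τ +
          2 * (s * deriv R (∫ θ, V θ * f k θ ∂τ)) * ∫ θ, V θ * u θ ∂τ := by
  choose next hnext h3 hiff using fun (g : {g : Θ →₁[τ] ℝ // IsSqDensity g}) =>
    exists_isSqDensity_forall_isMinOn_pgmStep_iff (V := V) (R := R) (hR := hR) (hR' := hR')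
      (hlip := hlip) hs g.2
  -- The recursion runs in the subtype of square-integrable densities, since each step needs its
  -- base point there.
  let F : ℕ → {g : Θ →₁[τ] ℝ // IsSqDensity g} := fun k =>
    Nat.rec ⟨Lp.const 1 τ (1 : ℝ), isSqDensity_const_one⟩ (fun _ g => ⟨next g, hnext g⟩) k
  have hF : ∀ k, (F (k + 1)).1 = next (F k) := fun k => rfl
  refine ⟨fun k => (F k).1, fun f' => ⟨fun hf' => ?_, ?_⟩, rfl, fun k => (F k).2, fun k => ?_⟩
  · funext k
    induction k with
    | zero => exact hf'.init
    | succ k ih =>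
      have := hf'.step k
      rw [ih] at this
      exact (hiff (F k) _).1 this
  · rintro rfl
    refine ⟨?_, rfl, fun k => (hiff (F k) _).2 (hF k)⟩
    rw [scalarObjective_H_of_isDensity isSqDensity_const_one.toIsDensity]
    exact ENNReal.zero_ne_top
  · simpa only [hF] using h3 (F k)

end ScalarObjective
-- Energy estimate and lower bounds on the iterates
section LowerBounds
open Filter
open scoped Topology

variable {Θ : Type*} [TopologicalSpace Θ] [MeasurableSpace Θ] {V : C(Θ, ℝ)} {R : ℝ → ℝ} {hR : ConvexOn ℝ univ R}
  {hR' : Differentiable ℝ R} {hlip : ∃ K : ℝ≥0, LipschitzWith K (gradient R)} {τ : Measure Θ}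

theorem integral_mul_nonneg_of_isDensity (hV0 : ∀ θ, 0 ≤ V θ) {f : Θ →₁[τ] ℝ}
    (hf : IsDensity f) : 0 ≤ ∫ θ, V θ * f θ ∂τ :=
  integral_nonneg_of_ae (by
    filter_upwards [hf.nonneg] with θ hθ
    exact mul_nonneg (hV0 θ) hθ)

variable [BorelSpace Θ] [IsProbabilityMeasure τ]

/-- These are the competitors: reaching the level `ρ` costs a squared norm of order `ρ ^ (-α)`. -/
theorem exists_isDensity_integral_mul_le (hV0 : ∀ θ, 0 ≤ V θ) {α c : ℝ} (hc : 0 < c)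
    (hlower : ∀ ρ : ℝ, 0 < ρ → ρ ≤ 1 → c * ρ ^ α ≤ τ.real {θ | V θ < ρ}) (ρ : ℝ) (hρ : 0 < ρ)
    (hρ1 : ρ ≤ 1) :
    ∃ u : Θ →₁[τ] ℝ, IsSqDensity u ∧ ∫ θ, V θ * u θ ∂τ ≤ ρ ∧
      ∫ θ, u θ ^ 2 ∂τ ≤ c⁻¹ * ρ ^ (-α) := by
  obtain ⟨u, hu, h1, h2⟩ := exists_isSqDensity_of_le_sublevel V.continuous.measurable hV0
    (v := c * ρ ^ α) (by positivity) (hlower ρ hρ hρ1)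
  refine ⟨u, hu, h1, h2.trans_eq ?_⟩
  rw [mul_inv, Real.rpow_neg hρ.le]

/-- The competitors with `ρ → 0` form a minimizing sequence, by continuity of `R`. -/
theorem iInf_scalarObjective_F (hV0 : ∀ θ, 0 ≤ V θ) {α c : ℝ} (hc : 0 < c)
    (hlower : ∀ ρ : ℝ, 0 < ρ → ρ ≤ 1 → c * ρ ^ α ≤ τ.real {θ | V θ < ρ})
    (hR0 : ∀ x, 0 ≤ x → 0 ≤ R x) (hR00 : R 0 = 0) :
    ⨅ f : Θ →₁[τ] ℝ, (scalarObjective V R hR hR' hlip).F τ f = 0 := by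
  refine le_antisymm ?_ (le_iInf fun f => scalarObjective_Fbar_nonneg hV0 hR0 _)
  choose u hu hu1 _ using fun n : ℕ => exists_isDensity_integral_mul_le hV0 hc hlower
    (1 / ((n : ℝ) + 1)) (by positivity) (by
      rw [div_le_one (by positivity)]
      have : (0 : ℝ) ≤ n := n.cast_nonneg
      linarith)
  have h1 : Tendsto (fun n => ∫ θ, V θ * u n θ ∂τ) atTop (𝓝 0) :=
    squeeze_zero (fun n => integral_mul_nonneg_of_isDensity hV0 (hu n).toIsDensity) hu1
      tendsto_one_div_add_atTop_nhds_zero_nat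
  have h2 : Tendsto (fun n => ((R (∫ θ, V θ * u n θ ∂τ) : ℝ) : EReal)) atTop (𝓝 0) := by
    have h3 := (hR'.continuous.tendsto 0).comp h1
    rw [hR00] at h3
    exact (continuous_coe_real_ereal.tendsto 0).comp h3
  refine ge_of_tendsto' h2 fun n => ?_
  rw [← scalarObjective_F (hR := hR) (hR' := hR') (hlip := hlip) (hu n).toIsDensity]
  exact iInf_le _ _

theorem isMinimizer_dirac (hV0 : ∀ θ, 0 ≤ V θ) {θ₀ : Θ} (hθ₀ : V θ₀ = 0) {α c : ℝ} (hc : 0 < c)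
    (hlower : ∀ ρ : ℝ, 0 < ρ → ρ ≤ 1 → c * ρ ^ α ≤ τ.real {θ | V θ < ρ})
    (hR0 : ∀ x, 0 ≤ x → 0 ≤ R x) (hR00 : R 0 = 0) :
    (scalarObjective V R hR hR' hlip).IsMinimizer τ (Measure.dirac θ₀).toSignedMeasure := by
  have h : (scalarObjective V R hR hR' hlip).Fbar (Measure.dirac θ₀).toSignedMeasure = 0 := by
    rw [Objective.Fbar, scalarObjective_Gbar, VectorMeasure.integral_toSignedMeasure,
      integral_dirac' _ _ V.continuous.measurable.stronglyMeasurable, hθ₀, hR00,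
      scalarObjective_Hbar_of_prob ⟨Measure.zero_le_toSignedMeasure _, by simp⟩]
    simp
  refine ⟨fun ν => ?_, ?_⟩
  · rw [h]
    exact scalarObjective_Fbar_nonneg hV0 hR0 ν
  · rw [h, iInf_scalarObjective_F hV0 hc hlower hR0 hR00]

/-- The energy estimate of the proximal gradient method, with the densities concentrated on
sublevel sets as competitors. -/
theorem integral_sq_add_sum_le (hV0 : ∀ θ, 0 ≤ V θ) {α c : ℝ} (hα : 0 < α) (hc : 0 < c)
    (hlower : ∀ ρ : ℝ, 0 < ρ → ρ ≤ 1 → c * ρ ^ α ≤ τ.real {θ | V θ < ρ})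
    {s : ℝ} (hs : 0 < s) {w : ℕ → ℝ} (hw : ∀ k, 0 ≤ w k) {f : ℕ → (Θ →₁[τ] ℝ)}
    (hf0 : f 0 = Lp.const 1 τ (1 : ℝ)) (hf : ∀ k, IsSqDensity (f k))
    (h3 : ∀ k, ∀ u : Θ →₁[τ] ℝ, IsSqDensity u →
      ∫ θ, (u θ - f (k + 1) θ) ^ 2 ∂τ + ∫ θ, (f (k + 1) θ - f k θ) ^ 2 ∂τ +
        2 * (s * w k) * ∫ θ, V θ * f (k + 1) θ ∂τ ≤
        ∫ θ, (u θ - f k θ) ^ 2 ∂τ + 2 * (s * w k) * ∫ θ, V θ * u θ ∂τ)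
    (ρ : ℝ) (hρ : 0 < ρ) (hρ1 : ρ ≤ 1) (k : ℕ) :
    ∫ θ, f k θ ^ 2 ∂τ + 4 * s * ∑ j ∈ Finset.range k, w j * ∫ θ, V θ * f (j + 1) θ ∂τ ≤
      (6 * c⁻¹ + 4) * ρ ^ (-α) + 4 * s * (ρ * ∑ j ∈ Finset.range k, w j) := by
  obtain ⟨u, hu, hu1, hu2⟩ := exists_isDensity_integral_mul_le hV0 hc hlower ρ hρ hρ1
  have h4 := add_two_mul_sum_le_of_forall_le
    (a := fun k => ∫ θ, (u θ - f k θ) ^ 2 ∂τ) (e := fun k => ∫ θ, (f (k + 1) θ - f k θ) ^ 2 ∂τ)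
    (m := fun k => ∫ θ, V θ * f k θ ∂τ) (t := fun k => s * w k) (M := ∫ θ, V θ * u θ ∂τ)
    (fun k => integral_nonneg fun θ => by positivity) (fun k => h3 k u hu) k
  simp only [mul_assoc, ← Finset.mul_sum] at h4
  -- Passing through `u` gives `N k ≤ 2 ‖u - f k‖² + 2 ‖u‖²` and `‖u - f 0‖² ≤ 2 ‖u‖² + 2`. Together
  -- these produce `6 ‖u‖² + 4`, and `ρ ^ (-α) ≥ 1` absorbs the `4`.
  have h5 := integral_sq_le_two_mul_add (hf k).memLp hu.memLp
  have h6 := integral_sub_sq_le_two_mul_add (hf 0).memLp hu.memLp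
  have h7 : ∫ θ, f 0 θ ^ 2 ∂τ = 1 := by
    rw [hf0]
    have : ∫ θ, (Lp.const 1 τ (1 : ℝ) : Θ → ℝ) θ ^ 2 ∂τ = ∫ _, (1 : ℝ) ∂τ := by
      exact integral_congr_ae (ae_of_all _ fun θ => by simp)
    rw [this]
    simp
  have h8 : 1 ≤ ρ ^ (-α) := Real.one_le_rpow_of_pos_of_le_one_of_nonpos hρ hρ1 (by linarith)
  have h9 : (∫ θ, V θ * u θ ∂τ) * (s * ∑ j ∈ Finset.range k, w j) ≤
      ρ * (s * ∑ j ∈ Finset.range k, w j) := by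
    have : 0 ≤ ∑ j ∈ Finset.range k, w j := Finset.sum_nonneg fun j _ => hw j
    gcongr
  linarith

theorem hasDerivAt_sq_div_two (x : ℝ) : HasDerivAt (fun x : ℝ => x ^ 2 / 2) x x := by
  simpa using (hasDerivAt_pow 2 x).div_const 2

theorem differentiable_sq_div_two : Differentiable ℝ fun x : ℝ => x ^ 2 / 2 := fun x =>
  (hasDerivAt_sq_div_two x).differentiableAt

theorem convexOn_sq_div_two : ConvexOn ℝ univ fun x : ℝ => x ^ 2 / 2 := by
  simpa [div_eq_inv_mul] using (even_two.convexOn_pow (𝕜 := ℝ)).smul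
    (show (0 : ℝ) ≤ 2⁻¹ by norm_num)

/-- The objective `∫ V dμ` on probability measures. -/
def linearObjective (V : C(Θ, ℝ)) : Objective Θ :=
  scalarObjective V (fun x => x) (convexOn_id convex_univ) differentiable_id ⟨0, by
    have : gradient (fun x : ℝ => x) = fun _ => 1 := by
      ext x
      rw [gradient_eq_deriv', deriv_id'']
    rw [this]
    exact LipschitzWith.const 1⟩

/-- The objective `(∫ V dμ)² / 2` on probability measures. -/
def quadraticObjective (V : C(Θ, ℝ)) : Objective Θ :=
  scalarObjective V (fun x => x ^ 2 / 2) convexOn_sq_div_two differentiable_sq_div_two ⟨1, by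
      have : gradient (fun x : ℝ => x ^ 2 / 2) = id := by
        ext x
        rw [gradient_eq_deriv', (hasDerivAt_sq_div_two x).deriv, id]
      rw [this]
      exact LipschitzWith.id⟩

variable [CompactSpace Θ]

/-- Here `R' = 1`, so all weights in the energy estimate are `1`. -/
theorem existsUnique_isPGM_and_le_linear (hV0 : ∀ θ, 0 ≤ V θ) {α c C : ℝ} (hα : 0 < α) (hc : 0 < c)
    (hC : 0 < C) (hV : ∀ ρ : ℝ, 0 < ρ → ρ ≤ 1 →
      c * ρ ^ α ≤ τ.real {θ | V θ < ρ} ∧ τ.real {θ | V θ < ρ} ≤ C * ρ ^ α) {s : ℝ} (hs : 0 < s) :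
    (∃! f : ℕ → (Θ →₁[τ] ℝ),
      (linearObjective V).IsPGM τ (powerEta 2) s (Lp.const 1 τ (1 : ℝ)) f) ∧
    ∃ c' : ℝ, 0 < c' ∧ ∀ f : ℕ → (Θ →₁[τ] ℝ),
      (linearObjective V).IsPGM τ (powerEta 2) s (Lp.const 1 τ (1 : ℝ)) f →
      ∀ k : ℕ, 1 ≤ k → ((c' * (k : ℝ) ^ (-1 / (α + 1)) : ℝ) : EReal) ≤
        (linearObjective V).F τ (f k) - ⨅ g : Θ →₁[τ] ℝ, (linearObjective V).F τ g := by
  have hlower := fun ρ h1 h2 => (hV ρ h1 h2).1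
  obtain ⟨f, hiff, hf0, hf, h3⟩ := existsUnique_isPGM (V := V) (τ := τ) (R := fun x => x)
    (hR := convexOn_id convex_univ) (hR' := differentiable_id) (hlip := _) hs
  simp only [deriv_id''] at h3
  obtain ⟨K, hK, hNK⟩ := exists_forall_le_mul_rpow_of_linear (A := 6 * c⁻¹ + 4)
    (N := fun k => ∫ θ, f k θ ^ 2 ∂τ) (m := fun k => ∫ θ, V θ * f k θ ∂τ) hs hα (by positivity)
    (fun k => integral_mul_nonneg_of_isDensity hV0 (hf k).toIsDensity) fun ρ hρ hρ1 k => by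
      have := integral_sq_add_sum_le hV0 hα hc hlower hs (w := fun _ => 1) (fun _ => zero_le_one)
        hf0 hf h3 ρ hρ hρ1 k
      simpa using this
  obtain ⟨c', hc', hc''⟩ := exists_mul_le_integral_mul_of_sublevel_le V.continuous.measurable hV0
    (fun θ => (le_abs_self _).trans (V.norm_coe_le_norm θ)) hα hC
    (fun ρ h1 h2 => (hV ρ h1 h2).2) hK
  refine ⟨⟨f, (hiff f).2 rfl, fun f' hf' => (hiff f').1 hf'⟩, c', hc', fun f' hf' k hk => ?_⟩
  obtain rfl := (hiff f').1 hf'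
  have hk1 : (1 : ℝ) ≤ k := by exact_mod_cast hk
  rw [linearObjective, iInf_scalarObjective_F hV0 hc hlower (fun x hx => hx) rfl,
    scalarObjective_F (hf k).toIsDensity, sub_zero, EReal.coe_le_coe_iff]
  exact hc'' _ (by positivity) (Real.rpow_le_one_of_one_le_of_nonpos hk1 (by
    rw [neg_div]; exact neg_nonpos.2 (by positivity))) _ (hf k) (hNK k hk)

/-- Here `R' x = x`: the steps weaken as `m k` decreases, which slows the growth of the norms, and
the value `m k ^ 2 / 2` squares the bound on `m k`. -/
theorem existsUnique_isPGM_and_le_quadratic (hV0 : ∀ θ, 0 ≤ V θ) {α c C : ℝ} (hα : 0 < α)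
    (hc : 0 < c) (hC : 0 < C) (hV : ∀ ρ : ℝ, 0 < ρ → ρ ≤ 1 →
      c * ρ ^ α ≤ τ.real {θ | V θ < ρ} ∧ τ.real {θ | V θ < ρ} ≤ C * ρ ^ α) {s : ℝ} (hs : 0 < s) :
    (∃! f : ℕ → (Θ →₁[τ] ℝ),
      (quadraticObjective V).IsPGM τ (powerEta 2) s (Lp.const 1 τ (1 : ℝ)) f) ∧
    ∃ c' : ℝ, 0 < c' ∧ ∀ f : ℕ → (Θ →₁[τ] ℝ),
      (quadraticObjective V).IsPGM τ (powerEta 2) s (Lp.const 1 τ (1 : ℝ)) f →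
      ∀ k : ℕ, 1 ≤ k → ((c' * (k : ℝ) ^ (-2 / (α + 2)) : ℝ) : EReal) ≤
        (quadraticObjective V).F τ (f k) - ⨅ g : Θ →₁[τ] ℝ, (quadraticObjective V).F τ g := by
  have hlower := fun ρ h1 h2 => (hV ρ h1 h2).1
  have hbound := fun {K : ℝ} (hK : 0 < K) =>
    exists_mul_le_integral_mul_of_sublevel_le (τ := τ) V.continuous.measurable hV0
    (fun θ => (le_abs_self _).trans (V.norm_coe_le_norm θ)) hα hC
    (fun ρ h1 h2 => (hV ρ h1 h2).2) hK
  obtain ⟨f, hiff, hf0, hf, h3⟩ := existsUnique_isPGM (V := V) (τ := τ) (R := fun x => x ^ 2 / 2)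
    (hR := convexOn_sq_div_two) (hR' := differentiable_sq_div_two) (hlip := _) hs
  simp only [(hasDerivAt_sq_div_two _).deriv] at h3
  have hm0 : ∀ k, 0 ≤ ∫ θ, V θ * f k θ ∂τ := fun k =>
    integral_mul_nonneg_of_isDensity hV0 (hf k).toIsDensity
  have hmpos : ∀ k, 0 < ∫ θ, V θ * f k θ ∂τ := by
    intro k
    have hN : 0 ≤ ∫ θ, f k θ ^ 2 ∂τ := integral_nonneg fun θ => by positivity
    -- The concentration bound at `ρ = 1`, with `K` above the squared norm of `f k`, gives strict
    -- positivity, so that `hanti` can divide by the weight.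
    obtain ⟨c', hc', h⟩ := hbound (show 0 < ∫ θ, f k θ ^ 2 ∂τ + 1 by positivity)
    have := h 1 one_pos le_rfl (f k) (hf k) (by simp)
    linarith
  have hanti : ∀ k, ∫ θ, V θ * f (k + 1) θ ∂τ ≤ ∫ θ, V θ * f k θ ∂τ := by
    intro k
    -- Testing with the current iterate shows descent.
    have h4 := h3 k (f k) (hf k)
    have h5 : (0 : ℝ) ≤ ∫ θ, (f k θ - f (k + 1) θ) ^ 2 ∂τ := integral_nonneg fun θ => by positivity
    have h6 : (0 : ℝ) ≤ ∫ θ, (f (k + 1) θ - f k θ) ^ 2 ∂τ := integral_nonneg fun θ => by positivity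
    have h7 : ∫ θ, (f k θ - f k θ) ^ 2 ∂τ = 0 := by simp
    rw [h7] at h4
    have h8 : 0 < 2 * (s * ∫ θ, V θ * f k θ ∂τ) := by have := hmpos k; positivity
    exact le_of_mul_le_mul_left (by linarith) h8
  obtain ⟨K, hK, hNK⟩ := exists_forall_le_mul_rpow_of_quadratic (A := 6 * c⁻¹ + 4)
    (N := fun k => ∫ θ, f k θ ^ 2 ∂τ) (m := fun k => ∫ θ, V θ * f k θ ∂τ) hs hα (by positivity)
    (fun k => integral_nonneg fun θ => by positivity) hm0 hanti
    (integral_sq_add_sum_le hV0 hα hc hlower hs hm0 hf0 hf h3)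
  obtain ⟨c', hc', hc''⟩ := hbound hK
  refine ⟨⟨f, (hiff f).2 rfl, fun f' hf' => (hiff f').1 hf'⟩, c' ^ 2 / 2, by positivity,
    fun f' hf' k hk => ?_⟩
  obtain rfl := (hiff f').1 hf'
  have hk1 : (1 : ℝ) ≤ k := by exact_mod_cast hk
  rw [quadraticObjective, iInf_scalarObjective_F hV0 hc hlower (fun x hx => by positivity)
    (by norm_num), scalarObjective_F (hf k).toIsDensity, sub_zero, EReal.coe_le_coe_iff]
  have h9 := hc'' _ (by positivity) (Real.rpow_le_one_of_one_le_of_nonpos hk1 (by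
    rw [neg_div]; exact neg_nonpos.2 (by positivity))) _ (hf k) (hNK k hk)
  have h10 : (k : ℝ) ^ (-2 / (α + 2)) = ((k : ℝ) ^ (-1 / (α + 2))) ^ 2 := by
    rw [← Real.rpow_mul_natCast (by positivity)]
    congr 1
    push_cast
    ring
  rw [h10]
  calc c' ^ 2 / 2 * ((k : ℝ) ^ (-1 / (α + 2))) ^ 2 = (c' * (k : ℝ) ^ (-1 / (α + 2))) ^ 2 / 2 := by
        ring
    _ ≤ _ := by gcongr

end LowerBounds
end

/-! ### The four settings -/

theorem mainTheorem3 {d : ℕ} (hd : 1 ≤ d) {Θ : Type*} [MetricSpace Θ] [CompactSpace Θ]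
    [MeasurableSpace Θ] [BorelSpace Θ]
    [ChartedSpace (EuclideanSpace ℝ (Fin d)) Θ] [IsManifold (𝓡 d) ∞ Θ]
    [RiemannianBundle (fun x : Θ => TangentSpace (𝓡 d) x)]
    [IsContMDiffRiemannianBundle (𝓡 d) ∞ (EuclideanSpace ℝ (Fin d))
      (fun x : Θ => TangentSpace (𝓡 d) x)]
    [IsRiemannianManifold (𝓡 d) Θ]
    (τ : Measure Θ) [IsProbabilityMeasure τ]
    (hτ : ∃ c : ℝ≥0∞, τ = c • (Measure.euclideanHausdorffMeasure d : Measure Θ))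
    (S : Setting) :
    ∃ P : Objective Θ,
      (∃ μ : SignedMeasure Θ, P.IsMinimizer τ μ ∧ S.Holds d P μ) ∧
      ∀ s : ℝ, 0 < s →
        (∃! f : ℕ → (Θ →₁[τ] ℝ), P.IsPGM τ (powerEta 2) s (Lp.const 1 τ (1 : ℝ)) f) ∧
        ∃ c : ℝ, 0 < c ∧
          ∀ f : ℕ → (Θ →₁[τ] ℝ), P.IsPGM τ (powerEta 2) s (Lp.const 1 τ (1 : ℝ)) f →
            ∀ k : ℕ, 1 ≤ k →
              ((c * (k : ℝ) ^ (-(S.q : ℝ) / ((d : ℝ) + (S.q : ℝ))) : ℝ) : EReal) ≤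
                P.F τ (f k) - ⨅ g : Θ →₁[τ] ℝ, P.F τ g := by
  have hd0 : (0 : ℝ) < d := by exact_mod_cast hd
  obtain ⟨θ₀⟩ : Nonempty Θ := nonempty_of_isProbabilityMeasure τ
  obtain ⟨c, C, hc, hC, hball, hball'⟩ := exists_measureReal_ball_comparable_pow τ hτ θ₀
  let V₁ : C(Θ, ℝ) := ⟨fun θ => dist θ θ₀, by fun_prop⟩
  have hV₁lip : LipschitzWith 1 V₁ := LipschitzWith.dist_left θ₀
  have hV₁0 : ∀ θ, 0 ≤ V₁ θ := fun θ => dist_nonneg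
  have hV₁θ₀ : V₁ θ₀ = 0 := dist_self θ₀
  obtain ⟨c₁, C₁, hc₁, hC₁, hV₁⟩ := exists_measureReal_sublevel_comparable_rpow τ hc hC hball
    hball' one_ne_zero one_pos one_pos (V := V₁) (fun θ => by simp [V₁])
  obtain ⟨W, hWs, a, b, ha, hb, hW⟩ := exists_contMDiff_comparable_dist_sq (d := d) θ₀
  let V₂ : C(Θ, ℝ) := ⟨W, hWs.continuous⟩
  have hV₂0 : ∀ θ, 0 ≤ V₂ θ := fun θ => le_trans (by positivity) (hW θ).1
  have hV₂θ₀ : V₂ θ₀ = 0 := le_antisymm ((hW θ₀).2.trans_eq (by simp)) (hV₂0 θ₀)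
  have hV₂lip : HasLipschitzGradient (d := d) V₂ := hWs.hasLipschitzGradient
  obtain ⟨c₂, C₂, hc₂, hC₂, hV₂⟩ := exists_measureReal_sublevel_comparable_rpow τ hc hC hball
    hball' two_ne_zero ha hb (V := V₂) hW
  have hsq0 : ∀ x : ℝ, 0 ≤ x → 0 ≤ x ^ 2 / 2 := fun x _ => by positivity
  -- At the Dirac mass `∫ V dμ = V θ₀ = 0`, and `R' 0 = 0` for the quadratic `R`.
  have hderiv : ∀ (V : C(Θ, ℝ)), V θ₀ = 0 → ∀ θ,
      (quadraticObjective V).GbarDeriv (Measure.dirac θ₀).toSignedMeasure θ = 0 := by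
    intro V hV θ
    rw [quadraticObjective, scalarObjective_GbarDeriv, VectorMeasure.integral_toSignedMeasure,
      integral_dirac' _ _ V.continuous.measurable.stronglyMeasurable, hV,
      (hasDerivAt_sq_div_two 0).deriv, zero_mul]
  cases S with
  | I =>
    refine ⟨linearObjective V₁, ⟨_, isMinimizer_dirac hV₁0 hV₁θ₀ hc₁ (fun ρ h1 h2 => (hV₁ ρ h1 h2).1)
      (fun x hx => hx) rfl, 1, hV₁lip⟩, fun s hs => ?_⟩
    have := existsUnique_isPGM_and_le_linear hV₁0 (by positivity) hc₁ hC₁ hV₁ hs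
    convert this using 12
    simp [Setting.q]
  | Istar =>
    refine ⟨quadraticObjective V₁, ⟨_, isMinimizer_dirac hV₁0 hV₁θ₀ hc₁
      (fun ρ h1 h2 => (hV₁ ρ h1 h2).1) hsq0 (by norm_num), ⟨1, hV₁lip⟩, hderiv V₁ hV₁θ₀⟩,
      fun s hs => ?_⟩
    have := existsUnique_isPGM_and_le_quadratic hV₁0 (by positivity) hc₁ hC₁ hV₁ hs
    convert this using 12
    simp [Setting.q]
  | II =>
    refine ⟨linearObjective V₂, ⟨_, isMinimizer_dirac hV₂0 hV₂θ₀ hc₂ (fun ρ h1 h2 => (hV₂ ρ h1 h2).1)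
      (fun x hx => hx) rfl, hV₂lip⟩, fun s hs => ?_⟩
    -- Now `α = d / 2`, and `-1 / (d / 2 + 1) = -2 / (d + 2)`.
    have := existsUnique_isPGM_and_le_linear hV₂0 (by positivity) hc₂ hC₂ hV₂ hs
    convert this using 12
    simp only [Setting.q]
    push_cast
    field_simp
  | IIstar =>
    refine ⟨quadraticObjective V₂, ⟨_, isMinimizer_dirac hV₂0 hV₂θ₀ hc₂
      (fun ρ h1 h2 => (hV₂ ρ h1 h2).1) hsq0 (by norm_num), hV₂lip, hderiv V₂ hV₂θ₀⟩,
      fun s hs => ?_⟩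
    -- Again `α = d / 2`, and `-2 / (d / 2 + 2) = -4 / (d + 4)`.
    have := existsUnique_isPGM_and_le_quadratic hV₂0 (by positivity) hc₂ hC₂ hV₂ hs
    convert this using 12
    simp only [Setting.q]
    push_cast
    field_simp
    ring
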